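/- Let $R$ be a commutative ring. Let $\mathbf{Sym}=R\langle S_1,S_2,\dots\rangle$ be the algebra of noncommutative symmetric functions (the free associative algebra on $S_1,S_2,\dots$, with $S_0=1$), and let $QSym$ be the algebra of quasi-symmetric functions over $R$, i.e. of the quasi-symmetric formal power series of bounded degree in $x_1,x_2,\dots$. They are paired by $\langle M_I,S^J\rangle=\delta_{IJ}$, where $M_I$ are the monomial quasi-symmetric functions and $S^J=S_{j_1}\cdots S_{j_s}$, with $I,J$ ranging over all compositions (finite sequences of positive integers, including the empty one). Let $g(t)=\sum_{n\ge0}g_nt^n\in\mathbf{Sym}[[t]]$ be the noncommutative Lagrange series, the unique solution of $g(t)=\sum_{n\ge0}S_n\,t^n g(t)^n$, and for a composition $I=(i_1,\dots,i_r)$ put $g^I=g_{i_1}\cdots g_{i_r}$. The *ordered cycle type* of a permutation $w\in\mathfrak S_N$ is the composition formed by the lengths of all its cycles (fixed points included), ordered by increasing values of their minima; its *reduced ordered cycle type* is obtained by subtracting $1$ from each part and removing the zeros. For $I=(i_1,\dots,i_r)$ let $|I|=i_1+\cdots+i_r$, and let $\sigma_I\in\mathfrak S_{|I|+r}$ be the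 permutation whose cycles are $$(1\,2\cdots i_1{+}1)\,(i_1{+}2\cdots i_1{+}i_2{+}2)\cdots(i_1{+}\cdots{+}i_{r-1}{+}r\,\cdots\, i_1{+}\cdots{+}i_r{+}r).$$ A factorization $\sigma=\alpha\beta$ in $\mathfrak S_N$ (composed from right to left) is *minimal* if $\ell(\alpha)+\ell(\beta)=\ell(\sigma)$, where $\ell(w)$ is the least number of transpositions whose product is $w$. Then $(g^I)_I$ is a basis of $\mathbf{Sym}$, and there is a unique family $(c_I)_I$ in $QSym$ dual to it, i.e. with $\langle c_I,g^J\rangle=\delta_{IJ}$ for all $I,J$; this family is a basis of $QSym$. For all compositions $I,J,K$, the coefficient $a^I_{JK}$ in the product $$c_Jc_K=\sum_I a^I_{JK}\,c_I$$ is equal to (the image in $R$ of) the number of pairs $(\alpha,\beta)$ of permutations in $\mathfrak S_{|I|+r}$, where $r$ is the length of $I$, such that $\sigma_I=\alpha\beta$ is a minimal factorization, $\alpha$ has reduced ordered cycle type $J$ and $\beta$ has reduced ordered cycle type $K$. -/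

import Mathlib

/-!
Compositions of arbitrary size are finite sequences of positive integers, `List ℕ+`; the empty
sequence is the composition of `0`.
-/

namespace LagrangeQSym

noncomputable section

/-! ### Noncommutative symmetric functions and the Lagrange basis -/

section NSym

variable (R : Type*) [CommRing R]

/-- Noncommutative symmetric functions: the free associative algebra on `S₁, S₂, …`. -/
abbrev NSym : Type _ := FreeAlgebra R ℕ+

/-- The complete functions `S_n`, with `S_0 = 1`. -/
def complete : ℕ → NSym R
  | 0 => 1
  | n + 1 => FreeAlgebra.ι R n.succPNat

/-- The operator `G(t) ↦ ∑_{k ≥ 0} S_k t^k G(t)^k` on power series over `NSym`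
(only the terms with `k ≤ n` contribute to the coefficient of `t^n`). -/
def lagrangeStep (G : PowerSeries (NSym R)) : PowerSeries (NSym R) :=
  PowerSeries.mk fun n =>
    ∑ k ∈ Finset.range (n + 1),
      complete R k * PowerSeries.coeff n ((PowerSeries.X : PowerSeries (NSym R)) ^ k * G ^ k)

/-- The noncommutative Lagrange series `g(t) = ∑ g_n t^n`, obtained by iterating `lagrangeStep`.
It is the unique solution of `g(t) = ∑_{k ≥ 0} S_k t^k g(t)^k`: see `lagrangeStep_lagrangeSeries`
and `eq_lagrangeSeries_of_lagrangeStep_eq`. -/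
def lagrangeSeries : PowerSeries (NSym R) :=
  PowerSeries.mk fun n => PowerSeries.coeff n ((lagrangeStep R)^[n + 1] 0)

/-- The homogeneous components `g_n` of the Lagrange series. -/
def lagrange (n : ℕ) : NSym R := PowerSeries.coeff n (lagrangeSeries R)

/-- The products `g^I = g_{i₁} g_{i₂} ⋯ g_{i_r}`. -/
def lagrangeMul (I : List ℕ+) : NSym R := (I.map fun i : ℕ+ => lagrange R (i : ℕ)).prod

variable {R}

theorem coeff_pow_congr {G H : PowerSeries (NSym R)} {m : ℕ}
    (h : ∀ i, i < m → PowerSeries.coeff i G = PowerSeries.coeff i H) (k : ℕ) :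
    ∀ i, i < m → PowerSeries.coeff i (G ^ k) = PowerSeries.coeff i (H ^ k) := by
  induction k with
  | zero => intro i _; simp
  | succ k ih =>
    intro i hi
    rw [pow_succ, pow_succ, PowerSeries.coeff_mul, PowerSeries.coeff_mul]
    refine Finset.sum_congr rfl fun p hp => ?_
    have := Finset.HasAntidiagonal.mem_antidiagonal.1 hp
    rw [ih p.1 (by omega), h p.2 (by omega)]

theorem coeff_lagrangeStep_congr {G H : PowerSeries (NSym R)} {m : ℕ}
    (h : ∀ i, i < m → PowerSeries.coeff i G = PowerSeries.coeff i H) :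
    ∀ i, i < m + 1 →
      PowerSeries.coeff i (lagrangeStep R G) = PowerSeries.coeff i (lagrangeStep R H) := by
  intro i hi
  simp only [lagrangeStep, PowerSeries.coeff_mk]
  refine Finset.sum_congr rfl fun k hk => ?_
  rcases Nat.eq_zero_or_pos k with rfl | hk0
  · simp
  · have := Finset.mem_range.1 hk
    rw [PowerSeries.coeff_X_pow_mul', PowerSeries.coeff_X_pow_mul',
      coeff_pow_congr h k (i - k) (by omega)]

theorem coeff_eq_iterate {G : PowerSeries (NSym R)} (hG : lagrangeStep R G = G) (m : ℕ) :
    ∀ i, i < m → PowerSeries.coeff i G = PowerSeries.coeff i ((lagrangeStep R)^[m] 0) := by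
  induction m with
  | zero => intro i hi; omega
  | succ m ih =>
    intro i hi
    rw [Function.iterate_succ_apply']
    conv_lhs => rw [← hG]
    exact coeff_lagrangeStep_congr ih i hi

/-- Uniqueness of the solution of the functional equation. -/
theorem eq_lagrangeSeries_of_lagrangeStep_eq {G : PowerSeries (NSym R)}
    (hG : lagrangeStep R G = G) : G = lagrangeSeries R := by
  ext n
  rw [coeff_eq_iterate hG (n + 1) n (by omega), lagrangeSeries, PowerSeries.coeff_mk]

theorem coeff_iterate_succ (m : ℕ) :
    ∀ i, i < m → PowerSeries.coeff i ((lagrangeStep R)^[m] (0 : PowerSeries (NSym R)))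
      = PowerSeries.coeff i ((lagrangeStep R)^[m + 1] 0) := by
  induction m with
  | zero => intro i hi; omega
  | succ m ih =>
    intro i hi
    rw [Function.iterate_succ_apply', Function.iterate_succ_apply' _ (m + 1)]
    exact coeff_lagrangeStep_congr ih i hi

theorem coeff_lagrangeSeries (m : ℕ) :
    ∀ i, i < m → PowerSeries.coeff i (lagrangeSeries R)
      = PowerSeries.coeff i ((lagrangeStep R)^[m] 0) := by
  induction m with
  | zero => intro i hi; omega
  | succ m ih =>
    intro i hi
    rcases Nat.lt_succ_iff_lt_or_eq.1 hi with h | rfl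
    · rw [ih i h, coeff_iterate_succ m i h]
    · rw [lagrangeSeries, PowerSeries.coeff_mk]

/-- The Lagrange series satisfies the functional equation. -/
theorem lagrangeStep_lagrangeSeries : lagrangeStep R (lagrangeSeries R) = lagrangeSeries R := by
  ext n
  rw [coeff_lagrangeSeries (n + 1) n (by omega), Function.iterate_succ_apply']
  exact coeff_lagrangeStep_congr (coeff_lagrangeSeries n) n (by omega)

end NSym

/-! ### Quasi-symmetric functions -/

section QSym

variable (R : Type*) [CommRing R]

/-- A power series in `x₀, x₁, x₂, …` is quasi-symmetric if the coefficients of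
`x_{i₁}^{a₁} ⋯ x_{i_k}^{a_k}` and `x_{j₁}^{a₁} ⋯ x_{j_k}^{a_k}` agree
whenever `i₁ < ⋯ < i_k` and `j₁ < ⋯ < j_k`. -/
def IsQuasiSymmetric {R : Type*} [CommRing R] (f : MvPowerSeries ℕ R) : Prop :=
  ∀ (k : ℕ) (a : Fin k →₀ ℕ) (i j : Fin k ↪o ℕ),
    MvPowerSeries.coeff (a.embDomain i.toEmbedding) f
      = MvPowerSeries.coeff (a.embDomain j.toEmbedding) f

/-- A power series of bounded degree. -/
def IsBoundedDegree {R : Type*} [CommRing R] (f : MvPowerSeries ℕ R) : Prop :=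
  ∃ d : ℕ, ∀ m : ℕ →₀ ℕ, d < m.degree → MvPowerSeries.coeff m f = 0

theorem coeff_embDomain_mul {R : Type*} [CommRing R] (f g : MvPowerSeries ℕ R) {k : ℕ}
    (a : Fin k →₀ ℕ) (i : Fin k ↪o ℕ) :
    MvPowerSeries.coeff (a.embDomain i.toEmbedding) (f * g)
      = ∑ p ∈ Finset.HasAntidiagonal.antidiagonal a, MvPowerSeries.coeff (p.1.embDomain i.toEmbedding) f *
          MvPowerSeries.coeff (p.2.embDomain i.toEmbedding) g := by
  classical
  rw [MvPowerSeries.coeff_mul]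
  symm
  refine Finset.sum_nbij
    (fun p => (p.1.embDomain i.toEmbedding, p.2.embDomain i.toEmbedding)) ?_ ?_ ?_ ?_
  · intro p hp
    rw [Finset.HasAntidiagonal.mem_antidiagonal] at hp ⊢
    rw [← hp, Finsupp.embDomain_add]
  · intro p _ q _ h
    simp only [Prod.mk.injEq] at h
    exact Prod.ext (Finsupp.embDomain_injective _ h.1) (Finsupp.embDomain_injective _ h.2)
  · intro p hp
    have hp' : p.1 + p.2 = a.embDomain i.toEmbedding := by simpa using hp
    have key : ∀ x : ℕ →₀ ℕ, x ≤ a.embDomain i.toEmbedding →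
        (x.comapDomain i i.injective.injOn).embDomain i.toEmbedding = x := by
      intro x hx
      ext n
      by_cases hn : n ∈ Set.range i
      · obtain ⟨t, rfl⟩ := hn
        have := Finsupp.embDomain_apply_self i.toEmbedding
          (x.comapDomain i i.injective.injOn) t
        simpa using this
      · rw [Finsupp.embDomain_of_notMem_range _ _ _ (by simpa using hn)]
        have := hx n
        rw [Finsupp.embDomain_of_notMem_range _ _ _ (by simpa using hn)] at this
        omega
    have h1 := key p.1 (hp' ▸ le_self_add)
    have h2 := key p.2 (hp' ▸ le_add_self)
    refine ⟨(p.1.comapDomain i i.injective.injOn, p.2.comapDomain i i.injective.injOn), ?_, ?_⟩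
    · simp only [Finset.mem_coe, Finset.HasAntidiagonal.mem_antidiagonal]
      apply Finsupp.embDomain_injective i.toEmbedding
      rw [Finsupp.embDomain_add, h1, h2, hp']
    · exact Prod.ext h1 h2
  · intro p _; rfl

/-- The algebra of quasi-symmetric functions: quasi-symmetric power series of bounded degree, with
the product of power series. -/
def QSym : Subalgebra R (MvPowerSeries ℕ R) where
  carrier := {f | IsQuasiSymmetric f ∧ IsBoundedDegree f}
  mul_mem' := by
    rintro f g ⟨hf, d, hd⟩ ⟨hg, e, he⟩
    refine ⟨fun k a i j => ?_, d + e, fun m hm => ?_⟩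
    · rw [coeff_embDomain_mul, coeff_embDomain_mul]
      exact Finset.sum_congr rfl fun p _ => by rw [hf k p.1 i j, hg k p.2 i j]
    · classical
      rw [MvPowerSeries.coeff_mul]
      refine Finset.sum_eq_zero fun p hp => ?_
      have h : p.1.degree + p.2.degree = m.degree := by
        rw [← Finset.HasAntidiagonal.mem_antidiagonal.1 hp, map_add]
      by_cases h1 : d < p.1.degree
      · rw [hd _ h1, zero_mul]
      · rw [he p.2 (by omega), mul_zero]
  add_mem' := by
    rintro f g ⟨hf, d, hd⟩ ⟨hg, e, he⟩
    refine ⟨fun k a i j => ?_, d + e, fun m hm => ?_⟩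
    · rw [map_add, map_add, hf k a i j, hg k a i j]
    · rw [map_add, hd m (by omega), he m (by omega), add_zero]
  algebraMap_mem' := by
    classical
    intro r
    refine ⟨fun k a i j => ?_, 0, fun m hm => ?_⟩
    · rw [MvPowerSeries.algebraMap_apply, MvPowerSeries.coeff_C, MvPowerSeries.coeff_C]
      simp only [Finsupp.embDomain_eq_zero]
    · rw [MvPowerSeries.algebraMap_apply, MvPowerSeries.coeff_C, if_neg]
      rintro rfl
      simp at hm

variable {R}

/-- The exponent vector of `x₀^{i₁} x₁^{i₂} ⋯ x_{r-1}^{i_r}`. -/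
def packedExponent (I : List ℕ+) : ℕ →₀ ℕ := (I.map fun i : ℕ+ => (i : ℕ)).toFinsupp

/-- The duality pairing between `QSym` and `NSym`, determined by `⟨M_I, S^J⟩ = δ_{IJ}` for the
monomial quasi-symmetric functions `M_I`. Since the coefficient of `M_J` in a quasi-symmetric
function `f` is its coefficient of `x₀^{j₁} ⋯ x_{r-1}^{j_r}`, this is the linear form on `NSym`
sending the basis element `S^J = S_{j₁} ⋯ S_{j_r}` to that coefficient. -/
def pairing (f : QSym R) : NSym R →ₗ[R] R :=
  (FreeAlgebra.basisFreeMonoid R ℕ+).constr R fun J =>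
    MvPowerSeries.coeff (packedExponent J.toList) (f : MvPowerSeries ℕ R)

/-- The family `c` of quasi-symmetric functions is dual to `(g^I)`: `⟨c_I, g^J⟩ = δ_{IJ}`. -/
def IsDualToLagrange (c : List ℕ+ → QSym R) : Prop :=
  ∀ I J : List ℕ+, pairing (c I) (lagrangeMul R J) = if I = J then 1 else 0

end QSym

end

/-! ### Permutations -/

/-- The number `|I| + r` of points moved by the canonical permutation of `I = (i₁, …, i_r)`. -/
def canonicalSize : List ℕ+ → ℕ
  | [] => 0
  | i :: I => ((i : ℕ) + 1) + canonicalSize I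

theorem canonicalSize_eq (I : List ℕ+) :
    canonicalSize I = (I.map fun i : ℕ+ => (i : ℕ)).sum + I.length := by
  induction I with
  | nil => rfl
  | cons i I ih =>
    simp only [canonicalSize, ih, List.map_cons, List.sum_cons, List.length_cons]
    omega

/-- The canonical permutation `σ_I = (1 2 … i₁+1)(i₁+2 … i₁+i₂+2) ⋯` (on points numbered from `0`):
the cycle `x ↦ x + 1` on the first `i₁ + 1` points, and the canonical permutation of
`(i₂, …, i_r)` shifted to the remaining points. -/
def canonicalPerm : (I : List ℕ+) → Equiv.Perm (Fin (canonicalSize I))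
  | [] => 1
  | i :: I => finSumFinEquiv.permCongr
      (Equiv.Perm.sumCongr (finRotate ((i : ℕ) + 1)) (canonicalPerm I))

/-- The ordered cycle type: the lengths of all cycles (fixed points included), ordered by
increasing minima of the cycles. -/
def orderedCycleType {N : ℕ} (w : Equiv.Perm (Fin N)) : List ℕ :=
  ((List.finRange N).filter fun i => ∀ j, w.SameCycle i j → i ≤ j).map fun i =>
    (Finset.univ.filter fun j => w.SameCycle i j).card

/-- The reduced ordered cycle type: subtract `1` from the parts of the ordered cycle type and
remove the zeros. -/
def reducedOrderedCycleType {N : ℕ} (w : Equiv.Perm (Fin N)) : List ℕ :=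
  ((orderedCycleType w).map fun l => l - 1).filter fun l => l ≠ 0

/-- The transposition length: the least number of transpositions whose product is `w`. -/
noncomputable def transpositionLength {N : ℕ} (w : Equiv.Perm (Fin N)) : ℕ :=
  sInf {n | ∃ l : List (Equiv.Perm (Fin N)), (∀ t ∈ l, t.IsSwap) ∧ l.prod = w ∧ l.length = n}

/-- `σ = αβ` is a minimal factorization: the transposition lengths of `α` and `β` add up to that
of `σ`. Products are composed from right to left. -/
def IsMinimalFactorization {N : ℕ} (σ α β : Equiv.Perm (Fin N)) : Prop :=
  α * β = σ ∧ transpositionLength α + transpositionLength β = transpositionLength σ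

/-- The minimal factorizations `σ_I = αβ` with `α` of reduced ordered cycle type `J` and `β` of
reduced ordered cycle type `K`. -/
def minimalFactorizations (I J K : List ℕ+) :
    Set (Equiv.Perm (Fin (canonicalSize I)) × Equiv.Perm (Fin (canonicalSize I))) :=
  {p | IsMinimalFactorization (canonicalPerm I) p.1 p.2 ∧
    reducedOrderedCycleType p.1 = J.map (fun j : ℕ+ => (j : ℕ)) ∧
    reducedOrderedCycleType p.2 = K.map (fun k : ℕ+ => (k : ℕ))}

end LagrangeQSym

/-! The product of `QSym` is dual to the coproduct `Δ S_n = ∑ S_i ⊗ S_{n-i}` of `NSym`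
(`pairing_mul`), so the structure constant is the coefficient of `g^J ⊗ g^K` in `Δ g^I`. Everything
reduces to the expansion of `Δ g^I` as the sum of `g^{type α} ⊗ g^{type β}` over the minimal
factorizations `σ_I = αβ` (`coproduct_lagrangeMul`). In a minimal factorization the cycles of the
factors lie inside the cycles of `σ` (`IsMinimalFactorization.sameCycle`). Hence the factorizations
of a direct sum are the pairs of factorizations of its summands, and since `Δ` is multiplicative
only `Δ g_n` and the long cycle on `n + 1` points remain (`coproduct_lagrange`).

Algebraic side (`lagrange_convolution`). Let `G = Δ g(t)`, `P = ∑ (S_i ⊗ 1) t^i G^i` and `B = ∑ (1 ⊗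
S_j) t^j G^j`. As the two families commute, `G = PB = BP`; comparing fixed point equations gives `P
= ∑ (g_k ⊗ 1) t^k B^k` and `B = ∑ (1 ⊗ g_k) t^k P^k`, a system with a unique solution. Then `G = PB
= ∑ (g_k ⊗ 1) t^k B^{k+1}`.

Combinatorial side (`coeff_eq_factorSum`). Among the minimal factorizations `αβ` of long cycles, let
`B` enumerate those where `α` fixes the first point and `P` those where `β` fixes the last point.
Multiplication by a suitable transposition cuts the long cycle into two shorter long cycles and
shortens by one the first cycle of `α`, or of `β` when `α` fixes the first point. Iterating the cut
yields the same system for `P` and `B`, and the same expression for the series `G` of all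
factorizations.

The dual family exists because `S_n ↦ g_n` is a graded automorphism of `NSym` (`lagrangeEquiv`): the
grading makes the coefficients `⟨f, g^I⟩` finitely supported and forces bounded degree
(`lagrangeCoeffs_bijective`). -/

namespace LagrangeQSym

/-! ### Series `∑ s_k X^k F_k` over a noncommutative ring -/

section OpSum

open Finset

variable {A : Type*} [Ring A]

/-- Congruence of power series modulo `X ^ m`. -/
def ModX (m : ℕ) (G H : PowerSeries A) : Prop :=
  ∀ i, i < m → PowerSeries.coeff i G = PowerSeries.coeff i H

theorem ModX.refl (m : ℕ) (G : PowerSeries A) : ModX m G G := fun _ _ => rfl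

theorem ModX.symm {m : ℕ} {G H : PowerSeries A} (h : ModX m G H) : ModX m H G :=
  fun i hi => (h i hi).symm

theorem ModX.trans {m : ℕ} {G H K : PowerSeries A} (h : ModX m G H) (h' : ModX m H K) :
    ModX m G K := fun i hi => (h i hi).trans (h' i hi)

theorem ModX.mul {m : ℕ} {G H G' H' : PowerSeries A} (h : ModX m G H) (h' : ModX m G' H') :
    ModX m (G * G') (H * H') := by
  intro i hi
  rw [PowerSeries.coeff_mul, PowerSeries.coeff_mul]
  refine sum_congr rfl fun p hp => ?_
  have := HasAntidiagonal.mem_antidiagonal.1 hp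
  rw [h p.1 (by omega), h' p.2 (by omega)]

theorem ModX.pow {m : ℕ} {G H : PowerSeries A} (h : ModX m G H) (k : ℕ) :
    ModX m (G ^ k) (H ^ k) := by
  induction k with
  | zero => simpa using ModX.refl m 1
  | succ k ih => rw [pow_succ, pow_succ]; exact ih.mul h

theorem eq_of_forall_modX {G H : PowerSeries A} (h : ∀ m, ModX m G H) : G = H := by
  ext n
  exact h (n + 1) n (by omega)

/-- The power series `∑ s_k X^k F_k`. -/
noncomputable def opSum (s : ℕ → A) (F : ℕ → PowerSeries A) : PowerSeries A :=
  PowerSeries.mk fun n => ∑ p ∈ antidiagonal n, s p.1 * PowerSeries.coeff p.2 (F p.1)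

theorem coeff_opSum (s : ℕ → A) (F : ℕ → PowerSeries A) (n : ℕ) :
    PowerSeries.coeff n (opSum s F)
      = ∑ p ∈ antidiagonal n, s p.1 * PowerSeries.coeff p.2 (F p.1) := by
  rw [opSum, PowerSeries.coeff_mk]

/-- The factor `X^(k+1)` gains one degree of precision, while the term `k = 0` has no such factor
and must agree exactly. This contraction drives the uniqueness and commutation arguments below. -/
theorem ModX.opSum {m : ℕ} (s : ℕ → A) {F F' : ℕ → PowerSeries A} (h0 : F 0 = F' 0)
    (h : ∀ k, ModX m (F (k + 1)) (F' (k + 1))) : ModX (m + 1) (opSum s F) (opSum s F') := by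
  intro n hn
  rw [coeff_opSum, coeff_opSum]
  refine sum_congr rfl fun p hp => ?_
  have hp' := HasAntidiagonal.mem_antidiagonal.1 hp
  rcases p with ⟨k, l⟩
  rcases k with _ | k
  · simp only [h0]
  · simp only at hp' ⊢
    rw [h k l (by omega)]

theorem ModX.opSum' {m : ℕ} (s : ℕ → A) {F F' : ℕ → PowerSeries A}
    (h : ∀ k, ModX m (F k) (F' k)) : ModX m (LagrangeQSym.opSum s F) (LagrangeQSym.opSum s F') := by
  intro n hn
  rw [coeff_opSum, coeff_opSum]
  refine sum_congr rfl fun p hp => ?_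
  have hp' := HasAntidiagonal.mem_antidiagonal.1 hp
  rw [h p.1 p.2 (by omega)]

theorem opSum_mul (s : ℕ → A) (F : ℕ → PowerSeries A) (B : PowerSeries A) :
    opSum s F * B = opSum s fun k => F k * B := by
  ext n
  simp only [PowerSeries.coeff_mul, coeff_opSum, sum_mul, mul_sum]
  rw [sum_sigma', sum_sigma']
  refine sum_nbij' (fun x => ⟨(x.2.1, x.2.2 + x.1.2), (x.2.2, x.1.2)⟩)
    (fun x => ⟨(x.1.1 + x.2.1, x.2.2), (x.1.1, x.2.1)⟩) ?_ ?_ ?_ ?_ ?_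
  all_goals rintro ⟨⟨a, b⟩, ⟨c, d⟩⟩ h
  all_goals simp only [mem_sigma, HasAntidiagonal.mem_antidiagonal] at h
  all_goals obtain ⟨rfl, h⟩ := h
  all_goals subst h
  · simp [add_assoc]
  · simp [add_assoc]
  · rfl
  · rfl
  · simp [mul_assoc]

/-- Double sums: `∑_n (∑_{i+j=n} a_i b_{ij}) X^n F_n = ∑_i a_i X^i ∑_j b_{ij} X^j F_{i+j}`. -/
theorem opSum_opSum (x a : ℕ → A) (b : ℕ → ℕ → A) (F : ℕ → PowerSeries A)
    (hx : ∀ n, x n = ∑ p ∈ antidiagonal n, a p.1 * b p.1 p.2) :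
    opSum x F = opSum a fun i => opSum (b i) fun j => F (i + j) := by
  ext n
  simp only [coeff_opSum, hx, sum_mul, mul_sum]
  rw [sum_sigma', sum_sigma']
  refine sum_nbij' (fun x => ⟨(x.2.1, x.2.2 + x.1.2), (x.2.2, x.1.2)⟩)
    (fun x => ⟨(x.1.1 + x.2.1, x.2.2), (x.1.1, x.2.1)⟩) ?_ ?_ ?_ ?_ ?_
  all_goals rintro ⟨⟨a, b⟩, ⟨c, d⟩⟩ h
  all_goals simp only [mem_sigma, HasAntidiagonal.mem_antidiagonal] at h
  all_goals obtain ⟨rfl, h⟩ := h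
  all_goals subst h
  · simp [add_assoc]
  · simp [add_assoc]
  · rfl
  · rfl
  · simp [mul_assoc]

theorem opSum_one_pow (B : PowerSeries A) :
    (opSum (fun k => PowerSeries.coeff k (1 : PowerSeries A)) fun k => B ^ k) = 1 := by
  ext n
  rw [coeff_opSum, sum_eq_single (0, n)]
  · simp
  · rintro ⟨k, l⟩ hkl hne
    have : k ≠ 0 := by
      rintro rfl
      simp at hkl hne
      omega
    simp [PowerSeries.coeff_one, this]
  · simp

theorem opSum_pow_add (s : ℕ → A) (B : PowerSeries A) (i : ℕ) :
    (opSum s fun j => B ^ (i + j)) = (opSum s fun j => B ^ j) * B ^ i := by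
  rw [opSum_mul]
  simp only [← pow_add, add_comm]

/-- The substitution `∑ P_m X^m B^m` is congruent to `A ^ n` when `P = u ^ n` and it is for `u`. -/
theorem modX_opSum_pow {m : ℕ} {u P B : PowerSeries A} (hPB : P * B = B * P)
    (h : ModX m (opSum (fun k => PowerSeries.coeff k u) fun k => B ^ k) P) (n : ℕ) :
    ModX m (opSum (fun k => PowerSeries.coeff k (u ^ n)) fun k => B ^ k) (P ^ n) := by
  induction n with
  | zero =>
    rw [pow_zero, pow_zero, opSum_one_pow]
    exact ModX.refl _ _
  | succ n ih =>
    rw [opSum_opSum _ (fun k => PowerSeries.coeff k u) (fun _ k => PowerSeries.coeff k (u ^ n)) _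
      (fun k => by rw [pow_succ', PowerSeries.coeff_mul])]
    simp only [opSum_pow_add]
    refine (ModX.opSum' _ fun k => ih.mul (ModX.refl m (B ^ k))).trans ?_
    -- The substitution produces `P^n B^k` to the right of the coefficient `u_k`; commutation lets
    -- `P^n` be pulled out of the sum on the right.
    have e2 : ∀ k, P ^ n * B ^ k = B ^ k * P ^ n := fun k =>
      (Commute.pow_pow (show Commute P B from hPB) n k).eq
    simp only [e2]
    rw [← opSum_mul, pow_succ']
    exact h.mul (ModX.refl m _)

/-- For fixed `i` the inner sum is `B G^i`, where `B = ∑ s'_j X^j G^j`. The factor `B` stands on the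
left of `G^i`, so this is not yet `PB`: that needs `B` to commute with `G`. -/
theorem opSum_convolution {s s' x : ℕ → A} {G : PowerSeries A}
    (hx : ∀ n, x n = ∑ p ∈ antidiagonal n, s p.1 * s' p.2)
    (hG : G = opSum x fun k => G ^ k) :
    G = opSum s fun i => (opSum s' fun j => G ^ j) * G ^ i := by
  conv_lhs => rw [hG, opSum_opSum x s (fun _ => s') _ hx]
  simp only [opSum_pow_add]

theorem ModX.pow_mul_comm {m : ℕ} {G B : PowerSeries A} (h : ModX m (G * B) (B * G)) (i : ℕ) :
    ModX m (G ^ i * B) (B * G ^ i) := by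
  induction i with
  | zero => simpa using ModX.refl m B
  | succ i ih =>
    have h1 := (ModX.refl m (G ^ i)).mul h
    have h2 := ih.mul (ModX.refl m G)
    rw [← mul_assoc, ← mul_assoc] at h1
    rw [mul_assoc B] at h2
    rw [pow_succ]
    exact h1.trans h2

/-- If `G = ∑ s_i s'_j X^{i+j} G^{i+j}` with the `s_i` commuting with the `s'_j`, then `G` is the
product, in any order, of `∑ s_i X^i G^i` and `∑ s'_j X^j G^j`. -/
theorem opSum_mul_opSum_eq {s s' x : ℕ → A} {G : PowerSeries A}
    (hc : ∀ i j, s i * s' j = s' j * s i)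
    (hx : ∀ n, x n = ∑ p ∈ antidiagonal n, s p.1 * s' p.2)
    (hG : G = opSum x fun k => G ^ k) :
    (opSum s fun k => G ^ k) * (opSum s' fun k => G ^ k) = G ∧
      (opSum s' fun k => G ^ k) * (opSum s fun k => G ^ k) = G := by
  have hx' : ∀ n, x n = ∑ p ∈ antidiagonal n, s' p.1 * s p.2 := fun n => by
    rw [hx, ← Nat.sum_antidiagonal_swap]
    exact sum_congr rfl fun p _ => hc _ _
  have h1 := opSum_convolution hx hG
  have h2 := opSum_convolution hx' hG
  set P := opSum s fun k => G ^ k with hP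
  set B := opSum s' fun k => G ^ k with hB
  -- Modulo `X^m`, the induction hypothesis gives `GB ≡ BPB ≡ BG`. In `h1` the factors `G^i` with `i
  -- ≥ 1` come with `X^i`, so exchanging `B` and `G^i` there is valid modulo `X^(m+1)`; likewise for
  -- `P` in `h2`.
  have key : ∀ m, ModX m (P * B) G ∧ ModX m (B * P) G := by
    intro m
    induction m with
    | zero => exact ⟨fun i hi => by omega, fun i hi => by omega⟩
    | succ m ih =>
      obtain ⟨ih1, ih2⟩ := ih
      have hGB : ModX m (G * B) (B * G) := by
        have := (ih2.symm.mul (ModX.refl m B))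
        rw [mul_assoc] at this
        exact this.trans ((ModX.refl m B).mul ih1)
      have hGP : ModX m (G * P) (P * G) := by
        have := (ih1.symm.mul (ModX.refl m P))
        rw [mul_assoc] at this
        exact this.trans ((ModX.refl m P).mul ih2)
      constructor
      · have := ModX.opSum (m := m) s (F := fun k => G ^ k * B) (F' := fun k => B * G ^ k)
          (by simp) fun k => hGB.pow_mul_comm _
        rwa [← opSum_mul, ← h1] at this
      · have := ModX.opSum (m := m) s' (F := fun k => G ^ k * P) (F' := fun k => P * G ^ k)
          (by simp) fun k => hGP.pow_mul_comm _
        rwa [← opSum_mul, ← h2] at this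
  exact ⟨eq_of_forall_modX fun m => (key m).1, eq_of_forall_modX fun m => (key m).2⟩

/-- If `u = ∑ s_k X^k u^k` and `P = ∑ s_k X^k P^k B^k` with `P` commuting with `B`, then
`P = ∑ u_k X^k B^k`. -/
theorem eq_opSum_coeff {s : ℕ → A} {u P B : PowerSeries A} (hPB : P * B = B * P)
    (hu : u = opSum s fun k => u ^ k) (hP : P = opSum s fun k => (P * B) ^ k) :
    P = opSum (fun k => PowerSeries.coeff k u) fun k => B ^ k := by
  refine (eq_of_forall_modX fun m => ?_).symm
  induction m with
  | zero => intro i hi; omega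
  | succ m ih =>
    -- The equation of `u` expresses its coefficients by those of its powers. By induction the
    -- substitution in `u^k` is `P^k` modulo `X^m`, and `P^k B^k = (PB)^k` turns this equation into
    -- the one satisfied by `P`.
    have e : (opSum (fun k => PowerSeries.coeff k u) fun k => B ^ k)
        = opSum s fun k => (opSum (fun l => PowerSeries.coeff l (u ^ k)) fun l => B ^ l) * B ^ k := by
      rw [opSum_opSum _ s (fun k l => PowerSeries.coeff l (u ^ k)) _
        (fun n => by conv_lhs => rw [hu, coeff_opSum])]
      simp only [opSum_pow_add]
    rw [e]
    conv in ModX _ _ _ => rw [hP]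
    refine ModX.opSum s ?_ fun k => ?_
    · simp only [pow_zero, opSum_one_pow, mul_one]
    · rw [(show Commute P B from hPB).mul_pow]
      exact (modX_opSum_pow hPB ih _).mul (ModX.refl _ _)

theorem opSum_system_unique {u v : ℕ → A} {P B P' B' : PowerSeries A}
    (hP : P = opSum u fun k => B ^ k) (hB : B = opSum v fun k => P ^ k)
    (hP' : P' = opSum u fun k => B' ^ k) (hB' : B' = opSum v fun k => P' ^ k) :
    P = P' ∧ B = B' := by
  have key : ∀ m, ModX m P P' ∧ ModX m B B' := by
    intro m
    induction m with
    | zero => exact ⟨fun i hi => by omega, fun i hi => by omega⟩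
    | succ m ih =>
      constructor
      · rw [hP, hP']
        exact ModX.opSum u (by simp) fun k => ih.2.pow _
      · rw [hB, hB']
        exact ModX.opSum v (by simp) fun k => ih.1.pow _
  exact ⟨eq_of_forall_modX fun m => (key m).1, eq_of_forall_modX fun m => (key m).2⟩

/-- The Lagrange series of a product of two commuting families, in terms of the two Lagrange
series. -/
theorem lagrange_convolution {s s' x : ℕ → A} {G u v P B : PowerSeries A}
    (hc : ∀ i j, s i * s' j = s' j * s i)
    (hx : ∀ n, x n = ∑ p ∈ antidiagonal n, s p.1 * s' p.2)
    (hG : G = opSum x fun k => G ^ k)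
    (hu : u = opSum s fun k => u ^ k) (hv : v = opSum s' fun k => v ^ k)
    (hP : P = opSum (fun k => PowerSeries.coeff k u) fun k => B ^ k)
    (hB : B = opSum (fun k => PowerSeries.coeff k v) fun k => P ^ k) :
    G = opSum (fun k => PowerSeries.coeff k u) fun k => B ^ (k + 1) := by
  obtain ⟨h1, h2⟩ := opSum_mul_opSum_eq hc hx hG
  set P' := opSum s fun k => G ^ k with hP'
  set B' := opSum s' fun k => G ^ k with hB'
  have e1 := eq_opSum_coeff (h1.trans h2.symm) hu (by rw [h1])
  have e2 := eq_opSum_coeff (h2.trans h1.symm) hv (by rw [h2])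
  -- The two factors of `G` solve the system that determines `P` and `B`.
  obtain ⟨rfl, rfl⟩ := opSum_system_unique hP hB e1 e2
  rw [← h1]
  conv_lhs => rw [e1, opSum_mul]
  simp only [pow_succ]

end OpSum

/-! ### The transposition length -/

section TranspositionLength

open Equiv Equiv.Perm

theorem SameCycle.mono_of_apply {α : Type*} {σ τ : Perm α} (h : ∀ i, SameCycle σ i (τ i)) {a b : α}
    (hab : SameCycle τ a b) : SameCycle σ a b := by
  obtain ⟨k, rfl⟩ := hab
  induction k using Int.induction_on with
  | zero => exact SameCycle.refl _ _
  | succ n ih =>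
    rw [add_comm, zpow_add, zpow_one, mul_apply]
    exact ih.trans (h _)
  | pred n ih =>
    refine ih.trans ?_
    have := h ((τ ^ (-(n : ℤ) - 1)) a)
    rw [← mul_apply, ← zpow_one_add] at this
    simpa using this.symm

theorem SameCycle.exists_lt_of_pow_eq {α : Type*} [Finite α] {g : Perm α} {x z : α} {k : ℕ}
    (hk : 0 < k) (hx : (g ^ k) x = x) (h : SameCycle g x z) : ∃ j < k, (g ^ j) x = z := by
  obtain ⟨n, hn⟩ := h.exists_nat_pow_eq
  refine ⟨n % k, Nat.mod_lt _ hk, ?_⟩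
  rw [← hn]
  have h1 : Function.IsPeriodicPt g k x := by
    rw [Function.IsPeriodicPt, Function.IsFixedPt, iterate_eq_pow, hx]
  have := h1.iterate_mod_apply n
  rwa [iterate_eq_pow, iterate_eq_pow] at this

/-- The first return to `{x, y}` of the orbit of `x`. -/
theorem exists_first_return {α : Type*} [Finite α] [DecidableEq α] (w : Perm α) (x y : α) :
    ∃ k, 0 < k ∧ ((w ^ k) x = x ∨ (w ^ k) x = y) ∧
      (∀ j, 0 < j → j < k → (w ^ j) x ≠ x ∧ (w ^ j) x ≠ y) ∧
      (∀ j, j < k → ((swap x y * w) ^ j) x = (w ^ j) x) ∧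
      ((swap x y * w) ^ k) x = swap x y ((w ^ k) x) := by
  classical
  have hex : ∃ k, 0 < k ∧ ((w ^ k) x = x ∨ (w ^ k) x = y) :=
    ⟨orderOf w, orderOf_pos w, by simp [pow_orderOf_eq_one]⟩
  have hmin : ∀ j, 0 < j → j < Nat.find hex → (w ^ j) x ≠ x ∧ (w ^ j) x ≠ y := by
    intro j hj hlt
    have := Nat.find_min hex hlt
    tauto
  have hlow : ∀ j, j < Nat.find hex → ((swap x y * w) ^ j) x = (w ^ j) x := by
    intro j
    induction j with
    | zero => simp
    | succ j ih =>
      intro hlt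
      rw [pow_succ', mul_apply, ih (by omega), mul_apply, ← mul_apply w, ← pow_succ']
      obtain ⟨h1, h2⟩ := hmin (j + 1) (by omega) hlt
      exact swap_apply_of_ne_of_ne h1 h2
  obtain ⟨h1, h2⟩ := Nat.find_spec hex
  refine ⟨Nat.find hex, h1, h2, hmin, hlow, ?_⟩
  obtain ⟨j, hj⟩ : ∃ j, Nat.find hex = j + 1 := ⟨Nat.find hex - 1, by omega⟩
  have := hlow j (by omega)
  rw [hj, pow_succ', mul_apply, this, mul_apply, ← mul_apply w, ← pow_succ']

/-- Where `w` would first reach `y`, the swap sends the orbit back to `x`; the new cycle of `x` is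
the arc of the old one from `x` to just before `y`. -/
theorem not_sameCycle_swap_mul {α : Type*} [Finite α] [DecidableEq α] {w : Perm α} {x y : α}
    (hxy : x ≠ y) (h : SameCycle w x y) : ¬ SameCycle (swap x y * w) x y := by
  obtain ⟨k, hk, hret, hmin, hlow, htop⟩ := exists_first_return w x y
  have hky : (w ^ k) x = y := by
    refine hret.resolve_left fun hx => ?_
    obtain ⟨j, hj, hjy⟩ := SameCycle.exists_lt_of_pow_eq hk hx h
    rcases Nat.eq_zero_or_pos j with rfl | hj0
    · exact hxy (by simpa using hjy)
    · exact (hmin j hj0 hj).2 hjy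
  rw [hky, swap_apply_right] at htop
  intro h'
  obtain ⟨j, hj, hjy⟩ := SameCycle.exists_lt_of_pow_eq hk htop h'
  rw [hlow j hj] at hjy
  rcases Nat.eq_zero_or_pos j with rfl | hj0
  · exact hxy (by simpa using hjy)
  · exact (hmin j hj0 hj).2 hjy

/-- The orbit of `x` under `w` returns to `x` without meeting `y`, and at that return the swap
redirects it to `y`. -/
theorem sameCycle_swap_mul {α : Type*} [Finite α] [DecidableEq α] {w : Perm α} {x y : α}
    (h : ¬ SameCycle w x y) : SameCycle (swap x y * w) x y := by
  obtain ⟨k, hk, hret, hmin, hlow, htop⟩ := exists_first_return w x y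
  have hkx : (w ^ k) x = x := hret.resolve_right fun hy => h ⟨k, by simpa using hy⟩
  rw [hkx, swap_apply_left] at htop
  exact ⟨k, by simpa using htop⟩

/-! ### Transposition length as `N` minus the number of cycles -/

variable {N : ℕ}

/-- The functions constant on the cycles of a permutation. -/
def invariants (w : Perm (Fin N)) : Submodule ℚ (Fin N → ℚ) where
  carrier := {f | ∀ i, f (w i) = f i}
  add_mem' ha hb i := by simp [ha i, hb i]
  zero_mem' _ := rfl
  smul_mem' c f hf i := by simp [hf i]

theorem mem_invariants {w : Perm (Fin N)} {f : Fin N → ℚ} :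
    f ∈ invariants w ↔ ∀ i, f (w i) = f i := Iff.rfl

theorem apply_eq_of_sameCycle {w : Perm (Fin N)} {f : Fin N → ℚ} (hf : f ∈ invariants w)
    {x y : Fin N} (h : SameCycle w x y) : f x = f y := by
  obtain ⟨k, rfl⟩ := h.exists_nat_pow_eq
  induction k with
  | zero => simp
  | succ k ih => rw [pow_succ', mul_apply, hf, ← ih ⟨k, by simp⟩]

theorem apply_swap_eq {f : Fin N → ℚ} {x y : Fin N} (h : f x = f y) (z : Fin N) :
    f (swap x y z) = f z := by
  rcases eq_or_ne z x with rfl | hx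
  · simp [h]
  rcases eq_or_ne z y with rfl | hy
  · simp [h]
  rw [swap_apply_of_ne_of_ne hx hy]

/-- The number of cycles. -/
noncomputable def cycleCount (w : Perm (Fin N)) : ℕ := Module.finrank ℚ (invariants w)

theorem cycleCount_le (w : Perm (Fin N)) : cycleCount w ≤ N := by
  have := Submodule.finrank_le (invariants w)
  simpa [cycleCount] using this

theorem cycleCount_one : cycleCount (1 : Perm (Fin N)) = N := by
  have : invariants (1 : Perm (Fin N)) = ⊤ := by
    ext f; simp [mem_invariants]
  rw [cycleCount, this, finrank_top]
  simp

/-- An invariant function of `w` taking equal values at `x` and `y` is also invariant under the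
product with the swap, and this condition costs at most one dimension. -/
theorem cycleCount_le_swap_mul (w : Perm (Fin N)) (x y : Fin N) :
    cycleCount w ≤ cycleCount (swap x y * w) + 1 := by
  let φ : (Fin N → ℚ) →ₗ[ℚ] ℚ := LinearMap.proj (R := ℚ) (φ := fun _ : Fin N => ℚ) x - LinearMap.proj y
  let ψ : invariants w →ₗ[ℚ] ℚ := φ ∘ₗ (invariants w).subtype
  have h1 := ψ.finrank_range_add_finrank_ker
  have h2 : Module.finrank ℚ (LinearMap.range ψ) ≤ 1 := by
    simpa using Submodule.finrank_le (LinearMap.range ψ)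
  have h3 : Module.finrank ℚ (LinearMap.ker ψ) ≤ cycleCount (swap x y * w) := by
    rw [← Submodule.finrank_map_subtype_eq]
    refine Submodule.finrank_mono ?_
    rintro _ ⟨f, hf, rfl⟩ i
    have hf' : f.1 x = f.1 y := by
      have : φ f.1 = 0 := hf
      simpa [φ, sub_eq_zero] using this
    simp only [Submodule.subtype_apply, mul_apply]
    rw [apply_swap_eq hf', f.2]
  rw [cycleCount]
  omega

/-- No invariant is lost, and one is gained: the indicator of the new cycle of `x` separates `x`
from `y`. The previous bound allows no further gain. -/
theorem cycleCount_swap_mul_of_sameCycle {w : Perm (Fin N)} {x y : Fin N} (hxy : x ≠ y)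
    (h : SameCycle w x y) : cycleCount (swap x y * w) = cycleCount w + 1 := by
  classical
  have h1 := cycleCount_le_swap_mul (swap x y * w) x y
  rw [swap_mul_self_mul] at h1
  have h2 : invariants w < invariants (swap x y * w) := by
    refine lt_of_le_of_ne (fun f hf i => ?_) fun heq => ?_
    · rw [mul_apply, apply_swap_eq (apply_eq_of_sameCycle hf h), hf]
    · let f : Fin N → ℚ := fun i => if SameCycle (swap x y * w) x i then 1 else 0
      have hf : f ∈ invariants (swap x y * w) := fun i => by
        simp only [f, sameCycle_apply_right]
      rw [← heq] at hf
      have := apply_eq_of_sameCycle hf h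
      simp only [f, if_neg (not_sameCycle_swap_mul hxy h), if_pos (SameCycle.refl _ x)] at this
      exact one_ne_zero this
  have h3 := Submodule.finrank_lt_finrank_of_lt h2
  simp only [cycleCount] at *
  omega

theorem le_cycleCount_add_length (l : List (Perm (Fin N))) (hl : ∀ t ∈ l, t.IsSwap) :
    N ≤ cycleCount l.prod + l.length := by
  induction l with
  | nil => simp [cycleCount_one]
  | cons t l ih =>
    obtain ⟨x, y, hxy, ht⟩ := hl t (by simp)
    have h1 := ih fun s hs => hl s (by simp [hs])
    have h2 := cycleCount_le_swap_mul l.prod x y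
    rw [List.prod_cons, List.length_cons, ht]
    omega

theorem exists_apply_ne {w : Perm (Fin N)} (h : w ≠ 1) : ∃ x, x ≠ w x := by
  by_contra! hc
  exact h (Equiv.ext fun x => (hc x).symm)

/-- As long as `w` moves some `x`, the swap of `x` and `w x` splits a cycle and raises the cycle
count by one. -/
theorem exists_swaps (w : Perm (Fin N)) :
    ∃ l : List (Perm (Fin N)), (∀ t ∈ l, t.IsSwap) ∧ l.prod = w ∧ l.length = N - cycleCount w := by
  induction hn : N - cycleCount w generalizing w with
  | zero =>
    refine ⟨[], by simp, ?_, rfl⟩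
    by_contra hne
    obtain ⟨x, hx⟩ := exists_apply_ne (Ne.symm hne)
    have h1 := cycleCount_swap_mul_of_sameCycle hx (sameCycle_apply_right.2 (SameCycle.refl w x))
    have := cycleCount_le (swap x (w x) * w)
    omega
  | succ n ih =>
    have hne : w ≠ 1 := by
      rintro rfl
      rw [cycleCount_one] at hn
      omega
    obtain ⟨x, hx⟩ := exists_apply_ne hne
    have h1 := cycleCount_swap_mul_of_sameCycle hx (sameCycle_apply_right.2 (SameCycle.refl w x))
    obtain ⟨l, hl, hp, hlen⟩ := ih (swap x (w x) * w) (by omega)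
    refine ⟨swap x (w x) :: l, ?_, ?_, by simp [hlen]⟩
    · rintro t ht
      rcases List.mem_cons.1 ht with rfl | ht
      · exact ⟨x, w x, hx, rfl⟩
      · exact hl t ht
    · rw [List.prod_cons, hp, swap_mul_self_mul]

theorem transpositionLength_eq (w : Perm (Fin N)) :
    transpositionLength w = N - cycleCount w := by
  refine le_antisymm (Nat.sInf_le (exists_swaps w)) (le_csInf ⟨_, exists_swaps w⟩ ?_)
  rintro _ ⟨l, hl, rfl, rfl⟩
  have := le_cycleCount_add_length l hl
  omega

theorem transpositionLength_one : transpositionLength (1 : Perm (Fin N)) = 0 := by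
  simp [transpositionLength_eq, cycleCount_one]

theorem transpositionLength_inv (w : Perm (Fin N)) :
    transpositionLength w⁻¹ = transpositionLength w := by
  have : invariants w⁻¹ = invariants w := by
    ext f
    refine ⟨fun h i => ?_, fun h i => ?_⟩
    · have := h (w i)
      simpa using this.symm
    · have := h (w⁻¹ i)
      simpa using this.symm
  rw [transpositionLength_eq, transpositionLength_eq, cycleCount, cycleCount, this]

theorem transpositionLength_mul_le (v w : Perm (Fin N)) :
    transpositionLength (v * w) ≤ transpositionLength v + transpositionLength w := by
  rw [transpositionLength_eq v, transpositionLength_eq w]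
  obtain ⟨l, hl, hp, hlen⟩ := exists_swaps v
  obtain ⟨l', hl', hp', hlen'⟩ := exists_swaps w
  refine Nat.sInf_le ⟨l ++ l', ?_, by simp [hp, hp'], by simp [hlen, hlen']⟩
  intro t ht
  rcases List.mem_append.1 ht with h | h
  exacts [hl t h, hl' t h]

theorem transpositionLength_swap_mul_of_sameCycle {w : Perm (Fin N)} {x y : Fin N} (hxy : x ≠ y)
    (h : SameCycle w x y) : transpositionLength (swap x y * w) + 1 = transpositionLength w := by
  have h1 := cycleCount_swap_mul_of_sameCycle hxy h
  have h2 := cycleCount_le (swap x y * w)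
  rw [transpositionLength_eq, transpositionLength_eq]
  omega

theorem transpositionLength_swap_mul_of_not {w : Perm (Fin N)} {x y : Fin N}
    (h : ¬ SameCycle w x y) : transpositionLength (swap x y * w) = transpositionLength w + 1 := by
  have hxy : x ≠ y := by
    rintro rfl
    exact h (SameCycle.refl _ _)
  have := transpositionLength_swap_mul_of_sameCycle hxy (sameCycle_swap_mul h)
  rw [swap_mul_self_mul] at this
  exact this.symm

theorem transpositionLength_mul_swap_of_sameCycle {w : Perm (Fin N)} {x y : Fin N} (hxy : x ≠ y)
    (h : SameCycle w x y) : transpositionLength (w * swap x y) + 1 = transpositionLength w := by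
  have := transpositionLength_swap_mul_of_sameCycle hxy (sameCycle_inv.2 h)
  rwa [transpositionLength_inv, ← transpositionLength_inv, mul_inv_rev, inv_inv, swap_inv] at this

/-- In a minimal factorization of `σ` the cycles of the factors are contained in those of `σ`. -/
theorem IsMinimalFactorization.sameCycle {σ α β : Perm (Fin N)}
    (h : IsMinimalFactorization σ α β) :
    (∀ i, SameCycle σ i (α i)) ∧ ∀ i, SameCycle σ i (β i) := by
  induction hn : transpositionLength α generalizing σ α with
  | zero =>
    have hα : α = 1 := by
      by_contra hne
      obtain ⟨x, hx⟩ := exists_apply_ne hne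
      have := transpositionLength_swap_mul_of_sameCycle hx
        (sameCycle_apply_right.2 (SameCycle.refl α x))
      omega
    obtain ⟨h1, -⟩ := h
    subst hα
    rw [one_mul] at h1
    subst h1
    exact ⟨fun i => SameCycle.refl _ _, fun i => sameCycle_apply_right.2 (SameCycle.refl _ _)⟩
  | succ n ih =>
    have hne : α ≠ 1 := by
      rintro rfl
      rw [transpositionLength_one] at hn
      omega
    obtain ⟨x, hx⟩ := exists_apply_ne hne
    have h1 := transpositionLength_swap_mul_of_sameCycle hx
      (sameCycle_apply_right.2 (SameCycle.refl α x))
    obtain ⟨hp, hl⟩ := h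
    have h2 := transpositionLength_mul_le (swap x (α x) * α) β
    rw [mul_assoc, hp] at h2
    -- Otherwise the swap would raise the length of `σ` by one, whereas `h2` bounds the new length
    -- by the old one minus one.
    have hs : SameCycle σ x (α x) := by
      by_contra hs
      have := transpositionLength_swap_mul_of_not hs
      omega
    have h3 := transpositionLength_swap_mul_of_sameCycle hx hs
    have h4 : IsMinimalFactorization (swap x (α x) * σ) (swap x (α x) * α) β :=
      ⟨by rw [mul_assoc, hp], by omega⟩
    obtain ⟨h5, h6⟩ := ih h4 (by omega)
    have ht : ∀ i, SameCycle σ i (swap x (α x) i) := by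
      intro i
      rcases eq_or_ne i x with rfl | hix
      · rwa [swap_apply_left]
      rcases eq_or_ne i (α x) with rfl | hiy
      · rw [swap_apply_right]
        exact hs.symm
      rw [swap_apply_of_ne_of_ne hix hiy]
    have h7 : ∀ i, SameCycle σ i ((swap x (α x) * σ) i) := fun i =>
      (sameCycle_apply_right.2 (SameCycle.refl σ i)).trans (ht _)
    refine ⟨fun i => ?_, fun i => SameCycle.mono_of_apply h7 (h6 i)⟩
    have := (SameCycle.mono_of_apply h7 (h5 i)).trans (ht _)
    rwa [← mul_apply, swap_mul_self_mul] at this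

end TranspositionLength

/-! ### Direct sums of permutations -/

section DirectSum

open Equiv Equiv.Perm

variable {m n : ℕ}

/-- The permutation acting by `α` on the first `m` points and by `β` on the other `n`. -/
def dsum (α : Perm (Fin m)) (β : Perm (Fin n)) : Perm (Fin (m + n)) :=
  finSumFinEquiv.permCongr (Perm.sumCongr α β)

@[simp] theorem dsum_castAdd (α : Perm (Fin m)) (β : Perm (Fin n)) (i : Fin m) :
    dsum α β (Fin.castAdd n i) = Fin.castAdd n (α i) := by
  simp [dsum, Equiv.permCongr_apply]

@[simp] theorem dsum_natAdd (α : Perm (Fin m)) (β : Perm (Fin n)) (i : Fin n) :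
    dsum α β (Fin.natAdd m i) = Fin.natAdd m (β i) := by
  simp [dsum, Equiv.permCongr_apply]

theorem dsum_mul (α α' : Perm (Fin m)) (β β' : Perm (Fin n)) :
    dsum α β * dsum α' β' = dsum (α * α') (β * β') := by
  ext x
  induction x using Fin.addCases <;> simp

@[simp] theorem dsum_one : dsum (1 : Perm (Fin m)) (1 : Perm (Fin n)) = 1 := by
  ext x
  induction x using Fin.addCases <;> simp

theorem dsum_injective {α α' : Perm (Fin m)} {β β' : Perm (Fin n)}
    (h : dsum α β = dsum α' β') : α = α' ∧ β = β' := by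
  constructor
  · ext i
    have := congrArg (fun w => (w (Fin.castAdd n i)).val) h
    simpa using this
  · ext i
    have := congrArg (fun w => (w (Fin.natAdd m i)).val) h
    simpa using this

theorem dsum_pow (α : Perm (Fin m)) (β : Perm (Fin n)) (k : ℕ) :
    dsum α β ^ k = dsum (α ^ k) (β ^ k) := by
  induction k with
  | zero => simp
  | succ k ih => rw [pow_succ, pow_succ, pow_succ, ih, dsum_mul]

theorem sameCycle_dsum_castAdd {α : Perm (Fin m)} {β : Perm (Fin n)} {i : Fin m}
    {x : Fin (m + n)} :
    SameCycle (dsum α β) (Fin.castAdd n i) x ↔ ∃ j, x = Fin.castAdd n j ∧ SameCycle α i j := by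
  constructor
  · intro h
    obtain ⟨k, hk⟩ := h.exists_nat_pow_eq
    rw [dsum_pow, dsum_castAdd] at hk
    exact ⟨_, hk.symm, k, by simp⟩
  · rintro ⟨j, rfl, h⟩
    obtain ⟨k, rfl⟩ := h.exists_nat_pow_eq
    exact ⟨k, by rw [zpow_natCast, dsum_pow, dsum_castAdd]⟩

theorem sameCycle_dsum_natAdd {α : Perm (Fin m)} {β : Perm (Fin n)} {i : Fin n}
    {x : Fin (m + n)} :
    SameCycle (dsum α β) (Fin.natAdd m i) x ↔ ∃ j, x = Fin.natAdd m j ∧ SameCycle β i j := by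
  constructor
  · intro h
    obtain ⟨k, hk⟩ := h.exists_nat_pow_eq
    rw [dsum_pow, dsum_natAdd] at hk
    exact ⟨_, hk.symm, k, by simp⟩
  · rintro ⟨j, rfl, h⟩
    obtain ⟨k, rfl⟩ := h.exists_nat_pow_eq
    exact ⟨k, by rw [zpow_natCast, dsum_pow, dsum_natAdd]⟩

theorem swap_mul_dsum_castAdd (α : Perm (Fin m)) (β : Perm (Fin n)) (x y : Fin m) :
    swap (Fin.castAdd n x) (Fin.castAdd n y) * dsum α β = dsum (swap x y * α) β := by
  have : swap (Fin.castAdd n x) (Fin.castAdd n y) = dsum (swap x y) 1 := by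
    ext z
    induction z using Fin.addCases with
    | left i =>
      rw [dsum_castAdd, swap_apply_def, swap_apply_def]
      simp only [Fin.castAdd_inj]
      split_ifs <;> rfl
    | right i =>
      rw [dsum_natAdd, one_apply, swap_apply_of_ne_of_ne] <;>
      · intro h
        have := congrArg Fin.val h
        simp at this
        omega
  rw [this, dsum_mul, one_mul]

theorem swap_mul_dsum_natAdd (α : Perm (Fin m)) (β : Perm (Fin n)) (x y : Fin n) :
    swap (Fin.natAdd m x) (Fin.natAdd m y) * dsum α β = dsum α (swap x y * β) := by
  have : swap (Fin.natAdd m x) (Fin.natAdd m y) = dsum 1 (swap x y) := by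
    ext z
    induction z using Fin.addCases with
    | right i =>
      rw [dsum_natAdd, swap_apply_def, swap_apply_def]
      simp only [Fin.natAdd_inj]
      split_ifs <;> rfl
    | left i =>
      rw [dsum_castAdd, one_apply, swap_apply_of_ne_of_ne] <;>
      · intro h
        have := congrArg Fin.val h
        simp at this
        omega
  rw [this, dsum_mul, one_mul]

/-- A swap splitting a cycle of one summand also splits a cycle of the direct sum, so both sides
drop by one together until everything is the identity. -/
theorem transpositionLength_dsum (α : Perm (Fin m)) (β : Perm (Fin n)) :
    transpositionLength (dsum α β) = transpositionLength α + transpositionLength β := by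
  induction hk : transpositionLength α + transpositionLength β using Nat.strong_induction_on
    generalizing α β with
  | _ k ih =>
    by_cases hα : α = 1
    · by_cases hβ : β = 1
      · subst hα hβ
        rw [dsum_one, transpositionLength_one, ← hk, transpositionLength_one,
          transpositionLength_one]
      · obtain ⟨x, hx⟩ := exists_apply_ne hβ
        have hc := sameCycle_apply_right.2 (SameCycle.refl β x)
        have h1 := transpositionLength_swap_mul_of_sameCycle hx hc
        have h2 := transpositionLength_swap_mul_of_sameCycle (w := dsum α β)
          (fun h => hx (Fin.natAdd_injective _ _ h))
          (sameCycle_dsum_natAdd.2 ⟨β x, rfl, hc⟩)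
        rw [swap_mul_dsum_natAdd, ih _ (by omega) α _ rfl] at h2
        omega
    · obtain ⟨x, hx⟩ := exists_apply_ne hα
      have hc := sameCycle_apply_right.2 (SameCycle.refl α x)
      have h1 := transpositionLength_swap_mul_of_sameCycle hx hc
      have h2 := transpositionLength_swap_mul_of_sameCycle (w := dsum α β)
        (fun h => hx (Fin.castAdd_injective _ _ h))
        (sameCycle_dsum_castAdd.2 ⟨α x, rfl, hc⟩)
      rw [swap_mul_dsum_castAdd, ih _ (by omega) _ β rfl] at h2
      omega

theorem exists_eq_dsum_of_sameCycle {w : Perm (Fin (m + n))} {σ : Perm (Fin m)}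
    {τ : Perm (Fin n)} (h : ∀ i, SameCycle (dsum σ τ) i (w i)) : ∃ α β, w = dsum α β := by
  have h1 : Set.MapsTo (finSumFinEquiv.symm.permCongr w) (Set.range Sum.inl)
      (Set.range (Sum.inl : Fin m → Fin m ⊕ Fin n)) := by
    rintro _ ⟨i, rfl⟩
    obtain ⟨j, hj, -⟩ := sameCycle_dsum_castAdd.1 (h (Fin.castAdd n i))
    exact ⟨j, by simp [Equiv.permCongr_apply, hj]⟩
  obtain ⟨⟨α, β⟩, hαβ⟩ := mem_sumCongrHom_range_of_perm_mapsTo_inl h1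
  refine ⟨α, β, ?_⟩
  have : Perm.sumCongr α β = finSumFinEquiv.symm.permCongr w := hαβ
  rw [dsum, this]
  ext x
  simp [Equiv.permCongr_apply]

theorem isMinimalFactorization_dsum {σ α α' : Perm (Fin m)} {τ β β' : Perm (Fin n)} :
    IsMinimalFactorization (dsum σ τ) (dsum α β) (dsum α' β') ↔
      IsMinimalFactorization σ α α' ∧ IsMinimalFactorization τ β β' := by
  simp only [IsMinimalFactorization, dsum_mul, transpositionLength_dsum]
  constructor
  · rintro ⟨h1, h2⟩
    obtain ⟨rfl, rfl⟩ := dsum_injective h1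
    -- Subadditivity holds in each block, so equality of the totals forces equality in both.
    have h3 := transpositionLength_mul_le α α'
    have h4 := transpositionLength_mul_le β β'
    exact ⟨⟨rfl, by omega⟩, rfl, by omega⟩
  · rintro ⟨⟨rfl, h1⟩, rfl, h2⟩
    exact ⟨rfl, by omega⟩

theorem isMinimalFactorization_dsum_iff {σ : Perm (Fin m)} {τ : Perm (Fin n)}
    {w w' : Perm (Fin (m + n))} :
    IsMinimalFactorization (dsum σ τ) w w' ↔ ∃ α α' β β', w = dsum α β ∧ w' = dsum α' β' ∧
      IsMinimalFactorization σ α α' ∧ IsMinimalFactorization τ β β' := by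
  constructor
  · intro h
    obtain ⟨α, β, rfl⟩ := exists_eq_dsum_of_sameCycle h.sameCycle.1
    obtain ⟨α', β', rfl⟩ := exists_eq_dsum_of_sameCycle h.sameCycle.2
    exact ⟨α, α', β, β', rfl, rfl, isMinimalFactorization_dsum.1 h⟩
  · rintro ⟨α, α', β, β', rfl, rfl, h⟩
    exact isMinimalFactorization_dsum.2 h

/-! ### Cutting the long cycle by a transposition -/

theorem finRotate_val {N : ℕ} (x : Fin N) :
    (finRotate N x : ℕ) = if (x : ℕ) + 1 = N then 0 else (x : ℕ) + 1 := by
  rcases N with _ | N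
  · exact x.elim0
  · rw [coe_finRotate]
    simp [Fin.ext_iff]

theorem sameCycle_finRotate {N : ℕ} (x y : Fin N) : SameCycle (finRotate N) x y := by
  rcases N with _ | _ | N
  · exact x.elim0
  · have : x = y := Fin.ext (by omega)
    rw [this]
  · have hne : ∀ z : Fin (N + 2), finRotate (N + 2) z ≠ z := fun z h => by
      have := congrArg Fin.val h
      rw [finRotate_val] at this
      split_ifs at this <;> omega
    exact isCycle_finRotate.sameCycle (hne x) (hne y)

theorem swap_val {N : ℕ} (a b x : Fin N) :
    (swap a b x : ℕ) = if (x : ℕ) = a then (b : ℕ) else if (x : ℕ) = b then (a : ℕ) else x := by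
  rw [swap_apply_def]
  simp only [Fin.ext_iff]
  split_ifs <;> rfl

/-- The swap exchanges the images `m` and `0` of the last points of the two blocks, so that each
block closes up. -/
theorem swap_mul_finRotate (hm : 0 < m) (hn : 0 < n) :
    swap (Fin.castAdd n ⟨0, hm⟩) (Fin.natAdd m ⟨0, hn⟩) * finRotate (m + n)
      = dsum (finRotate m) (finRotate n) := by
  ext x
  rw [mul_apply]
  induction x using Fin.addCases with
  | left i =>
    have := i.2
    simp only [dsum_castAdd, finRotate_val, swap_val, Fin.val_castAdd, Fin.val_natAdd]
    grind
  | right i =>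
    have := i.2
    simp only [dsum_natAdd, finRotate_val, swap_val, Fin.val_castAdd, Fin.val_natAdd]
    grind

theorem finRotate_mul_swap (hm : m - 1 < m) (hn : n - 1 < n) :
    finRotate (m + n) * swap (Fin.castAdd n ⟨m - 1, hm⟩) (Fin.natAdd m ⟨n - 1, hn⟩)
      = dsum (finRotate m) (finRotate n) := by
  ext x
  rw [mul_apply]
  induction x using Fin.addCases with
  | left i =>
    have := i.2
    simp only [dsum_castAdd, finRotate_val, swap_val, Fin.val_castAdd, Fin.val_natAdd]
    grind
  | right i =>
    have := i.2
    simp only [dsum_natAdd, finRotate_val, swap_val, Fin.val_castAdd, Fin.val_natAdd]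
    grind

/-- All points lie in the one cycle of `finRotate N`, so the swap lowers by one both the length of
`α` and that of the product. -/
theorem isMinimalFactorization_swap_mul_iff {N : ℕ} {α β : Perm (Fin N)} {x y : Fin N}
    (hxy : x ≠ y) (hα : SameCycle α x y) :
    IsMinimalFactorization (finRotate N) α β ↔
      IsMinimalFactorization (swap x y * finRotate N) (swap x y * α) β := by
  have h1 := transpositionLength_swap_mul_of_sameCycle hxy hα
  have h2 := transpositionLength_swap_mul_of_sameCycle hxy (sameCycle_finRotate x y)
  simp only [IsMinimalFactorization, mul_assoc, mul_right_inj]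
  exact and_congr_right fun _ => by omega

theorem isMinimalFactorization_mul_swap_iff {N : ℕ} {α β : Perm (Fin N)} {x y : Fin N}
    (hxy : x ≠ y) (hβ : SameCycle β x y) :
    IsMinimalFactorization (finRotate N) α β ↔
      IsMinimalFactorization (finRotate N * swap x y) α (β * swap x y) := by
  have h1 := transpositionLength_mul_swap_of_sameCycle hxy hβ
  have h2 := transpositionLength_mul_swap_of_sameCycle hxy (sameCycle_finRotate x y)
  simp only [IsMinimalFactorization, ← mul_assoc, mul_left_inj]
  exact and_congr_right fun _ => by omega

end DirectSum

/-! ### Codes of permutations -/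

section Code

open Equiv Equiv.Perm

variable {m n N : ℕ}

/-- The relation of lying in a common cycle, on natural numbers. -/
def CycleRel (w : Perm (Fin N)) (i j : ℕ) : Prop :=
  ∃ (hi : i < N) (hj : j < N), SameCycle w ⟨i, hi⟩ ⟨j, hj⟩

theorem CycleRel.symm {w : Perm (Fin N)} {i j : ℕ} : CycleRel w i j → CycleRel w j i :=
  fun ⟨hi, hj, h⟩ => ⟨hj, hi, h.symm⟩

theorem CycleRel.trans {w : Perm (Fin N)} {i j k : ℕ} :
    CycleRel w i j → CycleRel w j k → CycleRel w i k :=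
  fun ⟨hi, _, h⟩ ⟨_, hk, h'⟩ => ⟨hi, hk, h.trans h'⟩

theorem CycleRel.refl (w : Perm (Fin N)) {i : ℕ} (hi : i < N) : CycleRel w i i :=
  ⟨hi, hi, SameCycle.refl _ _⟩

theorem finite_cycleRel (w : Perm (Fin N)) (i : ℕ) : {j | CycleRel w i j}.Finite :=
  (Set.finite_Iio N).subset fun _ ⟨_, hj, _⟩ => hj

open Classical in
/-- The code of a permutation: at the minimum of a cycle its length minus `1`, and `0` elsewhere. -/
noncomputable def code (w : Perm (Fin N)) (i : ℕ) : ℕ :=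
  if ∀ j, CycleRel w i j → i ≤ j then {j | CycleRel w i j}.ncard - 1 else 0

theorem code_congr {w : Perm (Fin m)} {w' : Perm (Fin n)} {i : ℕ}
    (h : ∀ j, CycleRel w i j ↔ CycleRel w' i j) : code w i = code w' i := by
  simp only [code, h]
  classical exact if_congr (by simp only [h]) rfl rfl

theorem code_eq_zero_of_lt {w : Perm (Fin N)} {i j : ℕ} (h : CycleRel w i j) (hj : j < i) :
    code w i = 0 := by
  rw [code, if_neg]
  intro hc
  have := hc j h
  omega

theorem code_zero_add_one (w : Perm (Fin N)) (hN : 0 < N) :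
    code w 0 + 1 = {j | CycleRel w 0 j}.ncard := by
  rw [code, if_pos fun _ _ => Nat.zero_le _]
  have : 0 < {j | CycleRel w 0 j}.ncard :=
    (Set.ncard_pos (finite_cycleRel w 0)).2 ⟨0, CycleRel.refl w hN⟩
  omega

theorem cycleRel_of_fixed {w : Perm (Fin N)} {x : Fin N} (hx : w x = x) {j : ℕ} :
    CycleRel w x j ↔ j = x := by
  constructor
  · rintro ⟨_, hj, h⟩
    exact (congrArg Fin.val (h.eq_of_left hx)).symm
  · rintro rfl
    exact CycleRel.refl w x.2

theorem code_of_fixed {w : Perm (Fin N)} {x : Fin N} (hx : w x = x) : code w x = 0 := by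
  simp [code, cycleRel_of_fixed hx]

theorem code_zero_eq_zero_iff {w : Perm (Fin N)} (hN : 0 < N) :
    code w 0 = 0 ↔ w ⟨0, hN⟩ = ⟨0, hN⟩ := by
  constructor
  · intro h
    have h1 := code_zero_add_one w hN
    rw [h, zero_add, eq_comm, Set.ncard_eq_one] at h1
    obtain ⟨a, ha⟩ := h1
    have h2 : (0 : ℕ) ∈ ({a} : Set ℕ) := ha ▸ (CycleRel.refl w hN)
    have h3 : (w ⟨0, hN⟩ : ℕ) ∈ ({a} : Set ℕ) :=
      ha ▸ (⟨hN, (w ⟨0, hN⟩).2, sameCycle_apply_right.2 (SameCycle.refl _ _)⟩ : CycleRel w 0 _)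
    rw [Set.mem_singleton_iff] at h2 h3
    exact Fin.ext (by rw [h3, ← h2])
  · intro h
    exact code_of_fixed h

theorem cycleRel_dsum_left {α : Perm (Fin m)} {β : Perm (Fin n)} {i j : ℕ} (hi : i < m) :
    CycleRel (dsum α β) i j ↔ CycleRel α i j := by
  constructor
  · rintro ⟨h1, h2, h⟩
    obtain ⟨k, hk, h'⟩ := sameCycle_dsum_castAdd.1 (show SameCycle (dsum α β)
      (Fin.castAdd n ⟨i, hi⟩) ⟨j, h2⟩ from h)
    have : j = k := congrArg Fin.val hk
    subst this
    exact ⟨hi, k.2, h'⟩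
  · rintro ⟨h1, h2, h⟩
    exact ⟨by omega, by omega, sameCycle_dsum_castAdd.2 ⟨⟨j, h2⟩, rfl, h⟩⟩

theorem cycleRel_dsum_right {α : Perm (Fin m)} {β : Perm (Fin n)} {i j : ℕ} :
    CycleRel (dsum α β) (m + i) j ↔ ∃ k, j = m + k ∧ CycleRel β i k := by
  constructor
  · rintro ⟨h1, h2, h⟩
    obtain ⟨k, hk, h'⟩ := sameCycle_dsum_natAdd.1 (show SameCycle (dsum α β)
      (Fin.natAdd m ⟨i, by omega⟩) ⟨j, h2⟩ from h)
    exact ⟨k, congrArg Fin.val hk, by omega, k.2, h'⟩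
  · rintro ⟨k, rfl, h1, h2, h⟩
    exact ⟨by omega, by omega, sameCycle_dsum_natAdd.2 ⟨⟨k, h2⟩, rfl, h⟩⟩

theorem code_dsum_left (α : Perm (Fin m)) (β : Perm (Fin n)) {i : ℕ} (hi : i < m) :
    code (dsum α β) i = code α i := code_congr fun _ => cycleRel_dsum_left hi

theorem ncard_cycleRel_dsum_right (α : Perm (Fin m)) (β : Perm (Fin n)) (i : ℕ) :
    {j | CycleRel (dsum α β) (m + i) j}.ncard = {j | CycleRel β i j}.ncard := by
  rw [← Set.ncard_image_of_injective {j | CycleRel β i j} (add_right_injective m)]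
  congr 1
  ext j
  simp only [cycleRel_dsum_right, Set.mem_ofPred_eq, Set.mem_image, eq_comm, and_comm]

theorem code_dsum_right (α : Perm (Fin m)) (β : Perm (Fin n)) (i : ℕ) :
    code (dsum α β) (m + i) = code β i := by
  have : (∀ j, CycleRel (dsum α β) (m + i) j → m + i ≤ j) ↔ ∀ j, CycleRel β i j → i ≤ j := by
    simp only [cycleRel_dsum_right]
    constructor
    · intro h j hj
      have := h (m + j) ⟨j, rfl, hj⟩
      omega
    · rintro h _ ⟨k, rfl, hk⟩
      have := h k hk
      omega
  simp only [code, ncard_cycleRel_dsum_right]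
  classical exact if_congr this rfl rfl

/-! Inserting a fixed point `b` into the cycle of `a`. -/

/-- The product places `b` just before `a`: the former preimage of `a` now goes to `b`, and `b` to
`a`. Collapsing `b` onto `a` recovers the cycles of `w`. -/
theorem sameCycle_insert {w : Perm (Fin N)} {a b : Fin N} (hb : w b = b) (hab : a ≠ b)
    (i j : Fin N) : SameCycle (swap b a * w) i j ↔
      SameCycle w (if i = b then a else i) (if j = b then a else j) := by
  have hw : ∀ i, w i = b ↔ i = b := fun i => by
    rw [← w.injective.eq_iff (a := i), hb]
  have h1 : ∀ i, SameCycle w (if i = b then a else i)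
      (if (swap b a * w) i = b then a else (swap b a * w) i) := by
    intro i
    rw [mul_apply]
    by_cases hi : i = b
    · subst hi
      simpa [hb, hab] using SameCycle.refl w a
    · rw [if_neg hi]
      by_cases hia : w i = a
      · rw [hia, swap_apply_right, if_pos rfl, ← hia]
        exact sameCycle_apply_right.2 (SameCycle.refl _ _)
      · rw [swap_apply_of_ne_of_ne (mt (hw i).1 hi) hia, if_neg (mt (hw i).1 hi)]
        exact sameCycle_apply_right.2 (SameCycle.refl _ _)
  have hba : SameCycle (swap b a * w) b a := ⟨1, by simp [hb]⟩
  have h2 : ∀ i, SameCycle (swap b a * w) i (if i = b then a else i) := by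
    intro i
    split_ifs with hi
    · rw [hi]
      exact hba
    · exact SameCycle.refl _ _
  have h3 : ∀ i, SameCycle (swap b a * w) i (w i) := by
    intro i
    have h4 := sameCycle_apply_right.2 (SameCycle.refl (swap b a * w) i)
    rw [mul_apply] at h4
    by_cases hi : i = b
    · rw [hi, hb]
    by_cases hia : w i = a
    · rw [hia, swap_apply_right] at h4
      rw [hia]
      exact h4.trans hba
    · rwa [swap_apply_of_ne_of_ne (mt (hw i).1 hi) hia] at h4
  constructor
  · intro h
    obtain ⟨k, rfl⟩ := h.exists_nat_pow_eq
    clear h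
    induction k with
    | zero => exact SameCycle.refl _ _
    | succ k ih =>
      rw [pow_succ', mul_apply]
      exact ih.trans (h1 _)
  · intro h
    exact ((h2 i).trans (SameCycle.mono_of_apply h3 h)).trans (h2 j).symm

theorem cycleRel_insert {w : Perm (Fin N)} {a b : Fin N} (hb : w b = b) (hab : a ≠ b)
    {i j : ℕ} : CycleRel (swap b a * w) i j ↔
      CycleRel w (if i = b then (a : ℕ) else i) (if j = b then (a : ℕ) else j) := by
  have h : ∀ k, k < N ↔ (if k = b then (a : ℕ) else k) < N := by
    intro k
    split_ifs with hk <;> omega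
  have h' : ∀ (k : ℕ) (hk : k < N), (⟨if k = b then (a : ℕ) else k, (h k).1 hk⟩ : Fin N)
      = if (⟨k, hk⟩ : Fin N) = b then a else ⟨k, hk⟩ := by
    intro k hk
    simp only [Fin.ext_iff, apply_ite Fin.val]
  constructor
  · rintro ⟨hi, hj, hs⟩
    refine ⟨(h i).1 hi, (h j).1 hj, ?_⟩
    rw [h' i hi, h' j hj]
    exact (sameCycle_insert hb hab _ _).1 hs
  · rintro ⟨hi, hj, hs⟩
    refine ⟨(h i).2 hi, (h j).2 hj, (sameCycle_insert hb hab _ _).2 ?_⟩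
    rw [h' i ((h i).2 hi), h' j ((h j).2 hj)] at hs
    exact hs

theorem code_insert {w : Perm (Fin N)} {a b : Fin N} (hb : w b = b) (hab : a ≠ b) {i : ℕ}
    (hib : i ≠ b) (hia : ¬ CycleRel w i a) : code (swap b a * w) i = code w i := by
  refine code_congr fun j => ?_
  rw [cycleRel_insert hb hab, if_neg hib]
  split_ifs with hj
  · subst hj
    refine iff_of_false hia fun h => hib ?_
    exact (cycleRel_of_fixed hb).1 h.symm
  · rfl

theorem cycleRel_insert_self {w : Perm (Fin N)} {a b : Fin N} (hb : w b = b) (hab : a ≠ b) :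
    CycleRel (swap b a * w) b a := by
  rw [cycleRel_insert hb hab, if_pos rfl, if_neg (fun h => hab (Fin.ext h))]
  exact CycleRel.refl w a.2

/-- The enlarged cycle contains `0`, hence has its minimum there. Its length is one more than the
old cycle of `a`, and this one cancels the `- 1` in `code`. -/
theorem code_zero_insert {w : Perm (Fin N)} {a b : Fin N} (hb : w b = b) (hab : a ≠ b)
    (h0 : (a : ℕ) = 0 ∨ (b : ℕ) = 0) :
    code (swap b a * w) 0 = {j | CycleRel w a j}.ncard := by
  have hN : 0 < N := a.pos
  have h1 := code_zero_add_one (swap b a * w) hN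
  have hab' : (a : ℕ) ≠ b := fun h => hab (Fin.ext h)
  have h2 : {j | CycleRel (swap b a * w) 0 j} = insert (b : ℕ) {j | CycleRel w a j} := by
    ext j
    rw [Set.mem_ofPred_eq, cycleRel_insert hb hab]
    have : (if 0 = (b : ℕ) then (a : ℕ) else 0) = a := by
      split_ifs <;> omega
    rw [this, Set.mem_insert_iff, Set.mem_ofPred_eq]
    split_ifs with hj
    · simp [hj, CycleRel.refl w a.2]
    · simp [hj]
  rw [h2, Set.ncard_insert_of_notMem _ (finite_cycleRel w a)] at h1
  · omega
  · intro h
    exact hab' ((cycleRel_of_fixed hb).1 (CycleRel.symm h))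

end Code

/-! ### Weights of permutations -/

section Weight

open Equiv Equiv.Perm

variable {A : Type*} [Ring A] {m n N : ℕ}

/-- The product `u_{f(0)} u_{f(1)} ⋯ u_{f(N-1)}`. -/
def wordProd (u : ℕ → A) (f : ℕ → ℕ) (N : ℕ) : A := ((List.range N).map fun i => u (f i)).prod

theorem wordProd_add (u : ℕ → A) (f : ℕ → ℕ) (m n : ℕ) :
    wordProd u f (m + n) = wordProd u f m * wordProd u (fun i => f (m + i)) n := by
  simp [wordProd, List.range_add, Function.comp_def]

theorem wordProd_congr (u : ℕ → A) {f g : ℕ → ℕ} {N : ℕ} (h : ∀ i, i < N → f i = g i) :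
    wordProd u f N = wordProd u g N := by
  rw [wordProd, wordProd]
  congr 1
  refine List.map_congr_left fun i hi => ?_
  rw [h i (List.mem_range.1 hi)]

theorem wordProd_update_zero {u : ℕ → A} (hu : u 0 = 1) (f : ℕ → ℕ) (hN : 0 < N) :
    wordProd u f N = u (f 0) * wordProd u (Function.update f 0 0) N := by
  obtain ⟨n, rfl⟩ : ∃ n, N = 1 + n := ⟨N - 1, by omega⟩
  rw [wordProd_add, wordProd_add]
  simp [wordProd, hu, Function.update_apply]

theorem commute_wordProd {u v : ℕ → A} (h : ∀ i j, u i * v j = v j * u i) (f g : ℕ → ℕ)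
    (m n : ℕ) : wordProd u f m * wordProd v g n = wordProd v g n * wordProd u f m := by
  have : Commute (wordProd u f m) (wordProd v g n) := by
    refine Commute.list_prod_left _ _ fun x hx => Commute.list_prod_right _ _ fun y hy => ?_
    obtain ⟨i, -, rfl⟩ := List.mem_map.1 hx
    obtain ⟨j, -, rfl⟩ := List.mem_map.1 hy
    exact h _ _
  exact this

theorem wordProd_code_dsum (u : ℕ → A) (α : Perm (Fin m)) (β : Perm (Fin n)) :
    wordProd u (code (dsum α β)) (m + n) = wordProd u (code α) m * wordProd u (code β) n := by
  rw [wordProd_add]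
  congr 1
  · exact wordProd_congr u fun i hi => code_dsum_left α β hi
  · exact wordProd_congr u fun i _ => code_dsum_right α β i

theorem code_zero_swap_mul_dsum_left {α : Perm (Fin m)} {β : Perm (Fin n)} (hm : 0 < m)
    (hn : 0 < n) (hα : α ⟨0, hm⟩ = ⟨0, hm⟩) :
    code (swap (Fin.castAdd n ⟨0, hm⟩) (Fin.natAdd m ⟨0, hn⟩) * dsum α β) 0 = code β 0 + 1 := by
  rw [code_zero_insert (by rw [dsum_castAdd, hα]) (by simp [Fin.ext_iff]; omega) (Or.inr rfl),
    code_zero_add_one _ hn]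
  exact ncard_cycleRel_dsum_right α β 0

/-- Inserting the fixed point `0` into the cycle of `m` moves the minimum of that cycle from
position `m` to position `0` and leaves the other codes alone. The entry that moves is erased on
both sides, since its weight need not commute with the word of `α`. -/
theorem wordProd_swap_mul_dsum_left (u : ℕ → A) {α : Perm (Fin m)} {β : Perm (Fin n)} (hm : 0 < m)
    (hn : 0 < n) (hα : α ⟨0, hm⟩ = ⟨0, hm⟩) :
    wordProd u (Function.update
      (code (swap (Fin.castAdd n ⟨0, hm⟩) (Fin.natAdd m ⟨0, hn⟩) * dsum α β)) 0 0) (m + n)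
      = wordProd u (code α) m * wordProd u (Function.update (code β) 0 0) n := by
  set b := Fin.castAdd n (⟨0, hm⟩ : Fin m) with hbdef
  set a := Fin.natAdd m (⟨0, hn⟩ : Fin n) with hadef
  have hb : dsum α β b = b := by rw [hbdef, dsum_castAdd, hα]
  have hab : a ≠ b := by simp [hadef, hbdef, Fin.ext_iff]; omega
  have hb0 : (b : ℕ) = 0 := rfl
  have ham : (a : ℕ) = m := rfl
  rw [wordProd_add]
  congr 1
  · refine wordProd_congr u fun i hi => ?_
    rcases Nat.eq_zero_or_pos i with rfl | hi0
    · rw [Function.update_self]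
      exact ((code_zero_eq_zero_iff hm).2 hα).symm
    · rw [Function.update_of_ne (by omega), code_insert hb hab (by omega), code_dsum_left _ _ hi]
      rw [cycleRel_dsum_left hi, ham]
      rintro ⟨-, h, -⟩
      omega
  · refine wordProd_congr u fun i hi => ?_
    rw [Function.update_of_ne (by omega)]
    rcases Nat.eq_zero_or_pos i with rfl | hi0
    · rw [Function.update_self]
      exact code_eq_zero_of_lt (cycleRel_insert_self hb hab).symm (by omega)
    · rw [Function.update_of_ne (by omega)]
      by_cases hr : CycleRel β i 0
      · rw [code_eq_zero_of_lt hr hi0]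
        refine code_eq_zero_of_lt (j := 0) ?_ (by omega)
        rw [cycleRel_insert hb hab, if_neg (by omega), if_pos hb0.symm]
        exact cycleRel_dsum_right.2 ⟨0, by omega, hr⟩
      · rw [code_insert hb hab (by omega), code_dsum_right]
        rw [cycleRel_dsum_right]
        rintro ⟨k, hk, hr'⟩
        obtain rfl : k = 0 := by omega
        exact hr hr'

theorem code_zero_swap_mul_dsum_right {α : Perm (Fin m)} {β : Perm (Fin n)} (hm : 0 < m)
    (hn : n - 1 < n) (hβ : β ⟨n - 1, hn⟩ = ⟨n - 1, hn⟩) :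
    code (swap (Fin.natAdd m ⟨n - 1, hn⟩) (Fin.castAdd n ⟨0, hm⟩) * dsum α β) 0
      = code α 0 + 1 := by
  rw [code_zero_insert (by rw [dsum_natAdd, hβ]) (by simp [Fin.ext_iff]; omega) (Or.inl rfl),
    code_zero_add_one _ hm]
  congr 1
  ext j
  exact cycleRel_dsum_left hm

/-- The inserted point is the last one. It joins the cycle of `0`, so the minimum stays in place and
only the code at `0` changes. -/
theorem wordProd_swap_mul_dsum_right (u : ℕ → A) {α : Perm (Fin m)} {β : Perm (Fin n)}
    (hm : 0 < m) (hn : n - 1 < n) (hβ : β ⟨n - 1, hn⟩ = ⟨n - 1, hn⟩) :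
    wordProd u (Function.update
      (code (swap (Fin.natAdd m ⟨n - 1, hn⟩) (Fin.castAdd n ⟨0, hm⟩) * dsum α β)) 0 0) (m + n)
      = wordProd u (Function.update (code α) 0 0) m * wordProd u (code β) n := by
  set b := Fin.natAdd m (⟨n - 1, hn⟩ : Fin n) with hbdef
  set a := Fin.castAdd n (⟨0, hm⟩ : Fin m) with hadef
  have hb : dsum α β b = b := by rw [hbdef, dsum_natAdd, hβ]
  have hab : a ≠ b := by simp [hadef, hbdef, Fin.ext_iff]; omega
  have ha0 : (a : ℕ) = 0 := rfl
  have hbm : (b : ℕ) = m + (n - 1) := rfl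
  rw [wordProd_add]
  congr 1
  · refine wordProd_congr u fun i hi => ?_
    rcases Nat.eq_zero_or_pos i with rfl | hi0
    · rw [Function.update_self, Function.update_self]
    · rw [Function.update_of_ne (by omega), Function.update_of_ne (by omega)]
      by_cases hr : CycleRel α i 0
      · rw [code_eq_zero_of_lt hr hi0]
        refine code_eq_zero_of_lt (j := 0) ?_ (by omega)
        rw [cycleRel_insert hb hab, if_neg (by omega), if_neg (by omega)]
        exact (cycleRel_dsum_left hi).2 hr
      · rw [code_insert hb hab (by omega), code_dsum_left _ _ hi]
        rwa [cycleRel_dsum_left hi]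
  · refine wordProd_congr u fun i hi => ?_
    rw [Function.update_of_ne (by omega)]
    by_cases hin : i = n - 1
    · subst hin
      rw [show code β (n - 1) = 0 from code_of_fixed hβ]
      exact code_eq_zero_of_lt (cycleRel_insert_self hb hab) (by omega)
    · rw [code_insert hb hab (by omega), code_dsum_right]
      rw [cycleRel_dsum_right]
      rintro ⟨k, hk, hr'⟩
      omega

end Weight

/-! ### Recursive structure of the minimal factorizations of a long cycle -/

section Recursion

open Equiv Equiv.Perm Finset

variable {m n N : ℕ}

/-- The cut is made at the image `m` of the first point under `α`: the swap of `0` and `m` splits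
both `α` and the long cycle, and makes `0` a fixed point of the first factor. -/
theorem isMinimalFactorization_left_iff (hm : 0 < m) (hn : 0 < n) {α β : Perm (Fin (m + n))} :
    (IsMinimalFactorization (finRotate (m + n)) α β ∧
        α (Fin.castAdd n ⟨0, hm⟩) = Fin.natAdd m ⟨0, hn⟩) ↔
      ∃ α₁ β₁ α₂ β₂,
        α = swap (Fin.castAdd n ⟨0, hm⟩) (Fin.natAdd m ⟨0, hn⟩) * dsum α₁ α₂ ∧
        β = dsum β₁ β₂ ∧ α₁ ⟨0, hm⟩ = ⟨0, hm⟩ ∧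
        IsMinimalFactorization (finRotate m) α₁ β₁ ∧
        IsMinimalFactorization (finRotate n) α₂ β₂ := by
  set b := Fin.castAdd n (⟨0, hm⟩ : Fin m) with hb
  set a := Fin.natAdd m (⟨0, hn⟩ : Fin n) with ha
  have hba : b ≠ a := by simp [ha, hb, Fin.ext_iff]; omega
  constructor
  · rintro ⟨h, hα⟩
    rw [isMinimalFactorization_swap_mul_iff hba ⟨1, by simpa using hα⟩, swap_mul_finRotate hm hn,
      isMinimalFactorization_dsum_iff] at h
    obtain ⟨α₁, β₁, α₂, β₂, h1, rfl, h3, h4⟩ := h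
    refine ⟨α₁, β₁, α₂, β₂, by rw [← h1, swap_mul_self_mul], rfl, ?_, h3, h4⟩
    have : (swap b a * α) b = dsum α₁ α₂ b := by rw [h1]
    rw [mul_apply, hα, swap_apply_right, hb, dsum_castAdd] at this
    exact (Fin.castAdd_injective _ _ this).symm
  · rintro ⟨α₁, β₁, α₂, β₂, rfl, rfl, h2, h3, h4⟩
    have hα : (swap b a * dsum α₁ α₂) b = a := by
      rw [mul_apply, hb, dsum_castAdd, h2, swap_apply_left]
    refine ⟨?_, hα⟩
    rw [isMinimalFactorization_swap_mul_iff hba ⟨1, by simpa using hα⟩, swap_mul_finRotate hm hn,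
      swap_mul_self_mul, isMinimalFactorization_dsum]
    exact ⟨h3, h4⟩

theorem apply_last_of_apply_zero (hm : 0 < m) (hm' : m - 1 < m) {α β : Perm (Fin m)}
    (h : IsMinimalFactorization (finRotate m) α β) (hα : α ⟨0, hm⟩ = ⟨0, hm⟩) :
    β ⟨m - 1, hm'⟩ = ⟨0, hm⟩ := by
  apply α.injective
  rw [hα, ← mul_apply, h.1]
  ext
  rw [finRotate_val, if_pos (by simp only; omega)]

/-- Mirror image of the left cut, made at the preimage `m - 1` of the last point under `β`. The swap
now acts on the right and makes the last point a fixed point of the second factor. -/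
theorem isMinimalFactorization_right_iff (hm : 0 < m) (hm' : m - 1 < m) (hn : n - 1 < n)
    {α β : Perm (Fin (m + n))} :
    (IsMinimalFactorization (finRotate (m + n)) α β ∧
        α (Fin.castAdd n ⟨0, hm⟩) = Fin.castAdd n ⟨0, hm⟩ ∧
        β (Fin.castAdd n ⟨m - 1, hm'⟩) = Fin.natAdd m ⟨n - 1, hn⟩) ↔
      ∃ α₁ β₁ α₂ β₂, α = dsum α₁ α₂ ∧
        β = swap (Fin.natAdd m ⟨n - 1, hn⟩) (Fin.castAdd n ⟨0, hm⟩) * dsum β₁ β₂ ∧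
        α₁ ⟨0, hm⟩ = ⟨0, hm⟩ ∧ β₂ ⟨n - 1, hn⟩ = ⟨n - 1, hn⟩ ∧
        IsMinimalFactorization (finRotate m) α₁ β₁ ∧
        IsMinimalFactorization (finRotate n) α₂ β₂ := by
  set x := Fin.castAdd n (⟨m - 1, hm'⟩ : Fin m) with hx
  set y := Fin.natAdd m (⟨n - 1, hn⟩ : Fin n) with hy
  have hxy : x ≠ y := by simp [hx, hy, Fin.ext_iff]; omega
  -- Moving the swap to the left conjugates it by the direct sum: `β₁` sends `m - 1` to `0` and `β₂`
  -- fixes the last point. The left form is the one to which the insertion lemmas apply.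
  have key : ∀ {α₁ β₁ : Perm (Fin m)} {β₂ : Perm (Fin n)}, α₁ ⟨0, hm⟩ = ⟨0, hm⟩ →
      β₂ ⟨n - 1, hn⟩ = ⟨n - 1, hn⟩ → IsMinimalFactorization (finRotate m) α₁ β₁ →
      dsum β₁ β₂ * swap x y = swap y (Fin.castAdd n ⟨0, hm⟩) * dsum β₁ β₂ := by
    intro α₁ β₁ β₂ h1 h2 h3
    rw [mul_swap_eq_swap_mul, hx, hy, dsum_castAdd, dsum_natAdd, h2,
      apply_last_of_apply_zero hm hm' h3 h1, swap_comm]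
  constructor
  · rintro ⟨h, hα, hβ⟩
    rw [isMinimalFactorization_mul_swap_iff hxy ⟨1, by simpa using hβ⟩, finRotate_mul_swap hm' hn,
      isMinimalFactorization_dsum_iff] at h
    obtain ⟨α₁, β₁, α₂, β₂, rfl, h2, h3, h4⟩ := h
    rw [dsum_castAdd] at hα
    have h5 := Fin.castAdd_injective _ _ hα
    have h6 : β₂ ⟨n - 1, hn⟩ = ⟨n - 1, hn⟩ := by
      have := congrArg (fun w => w y) h2
      simp only [mul_apply, hβ, swap_apply_right] at this
      rw [hy, dsum_natAdd] at this
      exact (Fin.natAdd_injective _ _ this).symm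
    refine ⟨α₁, β₁, α₂, β₂, rfl, ?_, h5, h6, h3, h4⟩
    rw [← key h5 h6 h3, ← h2, mul_swap_mul_self]
  · rintro ⟨α₁, β₁, α₂, β₂, rfl, rfl, h1, h2, h3, h4⟩
    rw [← key h1 h2 h3]
    have hβ : (dsum β₁ β₂ * swap x y) x = y := by
      rw [mul_apply, swap_apply_left, hy, dsum_natAdd, h2]
    refine ⟨?_, by rw [dsum_castAdd, h1], hβ⟩
    rw [isMinimalFactorization_mul_swap_iff hxy ⟨1, by simpa using hβ⟩, finRotate_mul_swap hm' hn,
      mul_swap_mul_self, isMinimalFactorization_dsum]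
    exact ⟨h3, h4⟩

/-- The last point is fixed. -/
def FixesLast {N : ℕ} (w : Perm (Fin N)) : Prop := ∀ x : Fin N, (x : ℕ) + 1 = N → w x = x

theorem fixesLast_dsum (hn : 0 < n) {α : Perm (Fin m)} {β : Perm (Fin n)} :
    FixesLast (dsum α β) ↔ FixesLast β := by
  constructor
  · intro h x hx
    have := h (Fin.natAdd m x) (by simp; omega)
    rw [dsum_natAdd] at this
    exact Fin.natAdd_injective _ _ this
  · intro h x hx
    induction x using Fin.addCases with
    | left i =>
      simp at hx
      omega
    | right i =>
      rw [dsum_natAdd, h i (by simp at hx; omega)]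

variable {A : Type*} [Ring A]

open Classical in
/-- The minimal factorizations of the long cycle. -/
noncomputable def cycleFactorizations (N : ℕ) : Finset (Perm (Fin N) × Perm (Fin N)) :=
  univ.filter fun p => IsMinimalFactorization (finRotate N) p.1 p.2

theorem mem_cycleFactorizations {p : Perm (Fin N) × Perm (Fin N)} :
    p ∈ cycleFactorizations N ↔ IsMinimalFactorization (finRotate N) p.1 p.2 := by
  simp [cycleFactorizations]

open Classical in
/-- Total weight of the minimal factorizations `αβ` of the long cycle where `β` satisfies `S`. -/
noncomputable def factorSum (u v : ℕ → A) (S : ∀ N, Perm (Fin N) → Prop) (N : ℕ) : A :=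
  ∑ p ∈ cycleFactorizations N with S N p.2,
    wordProd u (code p.1) N * wordProd v (code p.2) N

open Classical in
/-- Total weight, not counting the first cycle of `α`, of the minimal factorizations `αβ` of the
long cycle where the first cycle of `α` has length `k + 1` and `β` satisfies `S`. -/
noncomputable def leftSum (u v : ℕ → A) (S : ∀ N, Perm (Fin N) → Prop) (k N : ℕ) : A :=
  ∑ p ∈ cycleFactorizations N with code p.1 0 = k ∧ S N p.2,
    wordProd u (Function.update (code p.1) 0 0) N * wordProd v (code p.2) N

open Classical in
/-- Total weight, not counting the first cycle of `β`, of the minimal factorizations `αβ` of the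
long cycle where `α` fixes the first point and the first cycle of `β` has length `k + 1`. -/
noncomputable def rightSum (u v : ℕ → A) (k N : ℕ) : A :=
  ∑ p ∈ cycleFactorizations N with code p.1 0 = 0 ∧ code p.2 0 = k,
    wordProd u (code p.1) N * wordProd v (Function.update (code p.2) 0 0) N

variable {u v : ℕ → A} {S : ∀ N, Perm (Fin N) → Prop}

open Classical in
-- The left cut makes `α₁` fix the first point and shortens the first cycle of `α` by one. The
-- hypothesis `hS` says that `S` only sees the last block, so it constrains `β₂` alone.
theorem leftSum_fiber (hc : ∀ i j, u i * v j = v j * u i)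
    (hS : ∀ (m n : ℕ) (α : Perm (Fin m)) (β : Perm (Fin n)), 0 < n → (S _ (dsum α β) ↔ S _ β))
    (k : ℕ) (hm : 0 < m) (hn : 0 < n) :
    ∑ p ∈ cycleFactorizations (m + n) with (code p.1 0 = k + 1 ∧ S (m + n) p.2) ∧
        p.1 (Fin.castAdd n ⟨0, hm⟩) = Fin.natAdd m ⟨0, hn⟩,
      wordProd u (Function.update (code p.1) 0 0) (m + n) * wordProd v (code p.2) (m + n)
      = leftSum u v (fun _ _ => True) 0 m * leftSum u v S k n := by
  rw [leftSum, leftSum, sum_mul_sum, ← sum_product']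
  symm
  refine sum_nbij (fun q => (swap (Fin.castAdd n ⟨0, hm⟩) (Fin.natAdd m ⟨0, hn⟩) *
    dsum q.1.1 q.2.1, dsum q.1.2 q.2.2)) ?_ ?_ ?_ ?_
  · rintro ⟨⟨α₁, β₁⟩, ⟨α₂, β₂⟩⟩ h
    simp only [mem_product, mem_filter, mem_cycleFactorizations, and_true] at h ⊢
    obtain ⟨⟨h1, h2⟩, h3, h4, h5⟩ := h
    rw [code_zero_eq_zero_iff hm] at h2
    obtain ⟨h6, h7⟩ := (isMinimalFactorization_left_iff hm hn).2
      ⟨α₁, β₁, α₂, β₂, rfl, rfl, h2, h1, h3⟩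
    exact ⟨h6, ⟨by rw [code_zero_swap_mul_dsum_left hm hn h2, h4], (hS _ _ _ _ hn).2 h5⟩, h7⟩
  · rintro ⟨⟨α₁, β₁⟩, ⟨α₂, β₂⟩⟩ - ⟨⟨α₁', β₁'⟩, ⟨α₂', β₂'⟩⟩ - h
    simp only [Prod.mk.injEq, mul_right_inj] at h
    obtain ⟨rfl, rfl⟩ := dsum_injective h.1
    obtain ⟨rfl, rfl⟩ := dsum_injective h.2
    rfl
  · rintro ⟨α, β⟩ h
    simp only [coe_filter, Set.mem_ofPred_eq, mem_cycleFactorizations] at h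
    obtain ⟨h1, ⟨h2, h3⟩, h4⟩ := h
    obtain ⟨α₁, β₁, α₂, β₂, rfl, rfl, h5, h6, h7⟩ :=
      (isMinimalFactorization_left_iff hm hn).1 ⟨h1, h4⟩
    rw [code_zero_swap_mul_dsum_left hm hn h5, Nat.add_right_cancel_iff] at h2
    refine ⟨((α₁, β₁), (α₂, β₂)), ?_, rfl⟩
    simp only [coe_product, Set.mem_prod, mem_coe, mem_filter, mem_cycleFactorizations, and_true]
    exact ⟨⟨h6, (code_zero_eq_zero_iff hm).2 h5⟩, h7, h2, (hS _ _ _ _ hn).1 h3⟩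
  · rintro ⟨⟨α₁, β₁⟩, ⟨α₂, β₂⟩⟩ h
    simp only [mem_product, mem_filter, mem_cycleFactorizations, and_true] at h
    obtain ⟨⟨h1, h2⟩, h3, h4, h5⟩ := h
    have h2' := (code_zero_eq_zero_iff hm).1 h2
    simp only
    rw [wordProd_swap_mul_dsum_left u hm hn h2', wordProd_code_dsum, mul_assoc, mul_assoc]
    congr 1
    · rw [Function.update_eq_self_iff.2 h2.symm]
    · rw [← mul_assoc, ← mul_assoc, commute_wordProd hc]

open Classical in
theorem rightSum_fiber (hc : ∀ i j, u i * v j = v j * u i) (k : ℕ) (hm : 0 < m)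
    (hm' : m - 1 < m) (hn : n - 1 < n) :
    ∑ p ∈ cycleFactorizations (m + n) with (code p.1 0 = 0 ∧ code p.2 0 = k + 1) ∧
        p.2 (Fin.castAdd n ⟨m - 1, hm'⟩) = Fin.natAdd m ⟨n - 1, hn⟩,
      wordProd u (code p.1) (m + n) * wordProd v (Function.update (code p.2) 0 0) (m + n)
      = rightSum u v k m * factorSum u v (fun _ => FixesLast) n := by
  have hl : ∀ β : Perm (Fin n), FixesLast β ↔ β ⟨n - 1, hn⟩ = ⟨n - 1, hn⟩ := by
    intro β
    refine ⟨fun h => h _ (by simp only; omega), fun h x hx => ?_⟩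
    have : x = ⟨n - 1, hn⟩ := Fin.ext (by simp only; omega)
    rw [this, h]
  have hmn : 0 < m + n := by omega
  rw [rightSum, factorSum, sum_mul_sum, ← sum_product']
  symm
  refine sum_nbij (fun q => (dsum q.1.1 q.2.1,
    swap (Fin.natAdd m ⟨n - 1, hn⟩) (Fin.castAdd n ⟨0, hm⟩) * dsum q.1.2 q.2.2)) ?_ ?_ ?_ ?_
  · rintro ⟨⟨α₁, β₁⟩, ⟨α₂, β₂⟩⟩ h
    simp only [mem_product, mem_filter, mem_cycleFactorizations, hl] at h ⊢
    obtain ⟨⟨h1, h2, h3⟩, h4, h5⟩ := h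
    rw [code_zero_eq_zero_iff hm] at h2
    obtain ⟨h6, h7, h8⟩ := (isMinimalFactorization_right_iff hm hm' hn).2
      ⟨α₁, β₁, α₂, β₂, rfl, rfl, h2, h5, h1, h4⟩
    exact ⟨h6, ⟨(code_zero_eq_zero_iff hmn).2 h7,
      by rw [code_zero_swap_mul_dsum_right hm hn h5, h3]⟩, h8⟩
  · rintro ⟨⟨α₁, β₁⟩, ⟨α₂, β₂⟩⟩ - ⟨⟨α₁', β₁'⟩, ⟨α₂', β₂'⟩⟩ - h
    simp only [Prod.mk.injEq, mul_right_inj] at h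
    obtain ⟨rfl, rfl⟩ := dsum_injective h.1
    obtain ⟨rfl, rfl⟩ := dsum_injective h.2
    rfl
  · rintro ⟨α, β⟩ h
    simp only [coe_filter, Set.mem_ofPred_eq, mem_cycleFactorizations] at h
    obtain ⟨h1, ⟨h2, h3⟩, h4⟩ := h
    obtain ⟨α₁, β₁, α₂, β₂, rfl, rfl, h5, h6, h7, h8⟩ :=
      (isMinimalFactorization_right_iff hm hm' hn).1 ⟨h1, (code_zero_eq_zero_iff hmn).1 h2, h4⟩
    rw [code_zero_swap_mul_dsum_right hm hn h6, Nat.add_right_cancel_iff] at h3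
    refine ⟨((α₁, β₁), (α₂, β₂)), ?_, rfl⟩
    simp only [coe_product, Set.mem_prod, mem_coe, mem_filter, mem_cycleFactorizations, hl]
    exact ⟨⟨h7, (code_zero_eq_zero_iff hm).2 h5, h3⟩, h8, h6⟩
  · rintro ⟨⟨α₁, β₁⟩, ⟨α₂, β₂⟩⟩ h
    simp only [mem_product, mem_filter, mem_cycleFactorizations, hl] at h
    obtain ⟨⟨h1, h2, h3⟩, h4, h5⟩ := h
    simp only
    rw [wordProd_swap_mul_dsum_right v hm hn h5, wordProd_code_dsum, mul_assoc, mul_assoc]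
    congr 1
    rw [← mul_assoc, ← mul_assoc, commute_wordProd hc]

theorem code_zero_lt (w : Perm (Fin (N + 1))) : code w 0 ≤ N := by
  have h1 := code_zero_add_one w (Nat.succ_pos N)
  have h2 := Set.ncard_le_ncard (fun j ⟨_, hj, _⟩ => hj : {j | CycleRel w 0 j} ⊆ Set.Iio (N + 1))
    (Set.finite_Iio _)
  rw [Set.ncard_Iio_nat] at h2
  omega

open Classical in
-- The fiber condition is expressed by natural number values, so that `N` need not be literally of
-- the form `m + n` when the fibers are summed.
theorem leftSum_fiber' (hc : ∀ i j, u i * v j = v j * u i)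
    (hS : ∀ (m n : ℕ) (α : Perm (Fin m)) (β : Perm (Fin n)), 0 < n → (S _ (dsum α β) ↔ S _ β))
    (k : ℕ) (hm : 0 < m) (hn : 0 < n) (hN : m + n = N) :
    ∑ p ∈ cycleFactorizations N with (code p.1 0 = k + 1 ∧ S N p.2) ∧
        ∀ x : Fin N, (x : ℕ) = 0 → (p.1 x : ℕ) = m,
      wordProd u (Function.update (code p.1) 0 0) N * wordProd v (code p.2) N
      = leftSum u v (fun _ _ => True) 0 m * leftSum u v S k n := by
  subst hN
  rw [← leftSum_fiber hc hS k hm hn]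
  congr 1
  refine filter_congr fun p _ => and_congr_right fun _ => ?_
  constructor
  · intro h
    exact Fin.ext (h _ rfl)
  · intro h x hx
    rw [show x = Fin.castAdd n ⟨0, hm⟩ from Fin.ext hx, h]
    rfl

open Classical in
theorem rightSum_fiber' (hc : ∀ i j, u i * v j = v j * u i) (k : ℕ) (hm : 0 < m) (hn : 0 < n)
    (hN : m + n = N) :
    ∑ p ∈ cycleFactorizations N with (code p.1 0 = 0 ∧ code p.2 0 = k + 1) ∧
        ∀ x : Fin N, (x : ℕ) + 1 = m → (p.2 x : ℕ) + 1 = N,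
      wordProd u (code p.1) N * wordProd v (Function.update (code p.2) 0 0) N
      = rightSum u v k m * factorSum u v (fun _ => FixesLast) n := by
  subst hN
  rw [← rightSum_fiber hc k hm (by omega) (by omega)]
  congr 1
  refine filter_congr fun p _ => and_congr_right fun _ => ?_
  constructor
  · intro h
    have := h (Fin.castAdd n ⟨m - 1, by omega⟩) (by simp; omega)
    refine Fin.ext ?_
    simp only [Fin.val_natAdd]
    omega
  · intro h x hx
    rw [show x = Fin.castAdd n ⟨m - 1, by omega⟩ from Fin.ext (by simp; omega), h]
    simp
    omega

open Classical in
theorem leftSum_succ_succ (hc : ∀ i j, u i * v j = v j * u i)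
    (hS : ∀ (m n : ℕ) (α : Perm (Fin m)) (β : Perm (Fin n)), 0 < n → (S _ (dsum α β) ↔ S _ β))
    (k N : ℕ) :
    leftSum u v S (k + 1) (N + 2) = ∑ p ∈ antidiagonal N,
      leftSum u v (fun _ _ => True) 0 (p.1 + 1) * leftSum u v S k (p.2 + 1) := by
  have hpos : ∀ p ∈ (cycleFactorizations (N + 2)).filter
      (fun p => code p.1 0 = k + 1 ∧ S (N + 2) p.2), (p.1 0 : ℕ) ≠ 0 := by
    intro p hp h0
    have := (code_zero_eq_zero_iff (Nat.succ_pos _)).2 (Fin.ext h0 : p.1 0 = 0)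
    have := (mem_filter.1 hp).2.1
    omega
  -- The image of the first point under `α` is nonzero and equals the size `q.1 + 1` of the first
  -- block.
  rw [leftSum, ← sum_fiberwise_of_maps_to (t := antidiagonal N)
    (g := fun p => ((p.1 0 : ℕ) - 1, N + 1 - (p.1 0 : ℕ)))]
  · refine sum_congr rfl fun q hq => ?_
    rw [HasAntidiagonal.mem_antidiagonal] at hq
    rw [← leftSum_fiber' hc hS k (Nat.succ_pos q.1) (Nat.succ_pos q.2)
      (show q.1 + 1 + (q.2 + 1) = N + 2 by omega), filter_filter]
    refine sum_congr ?_ fun _ _ => rfl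
    ext p
    rw [mem_filter, mem_filter]
    refine and_congr_right fun hp => and_congr_right fun hp' => ?_
    have := hpos p (mem_filter.2 ⟨hp, hp'⟩)
    rw [Prod.ext_iff]
    constructor
    · intro h x hx
      obtain rfl : x = 0 := Fin.ext hx
      simp only at h
      omega
    · intro h
      have := h 0 rfl
      simp only
      omega
  · intro p hp
    have := hpos p hp
    rw [HasAntidiagonal.mem_antidiagonal]
    simp only
    omega

theorem apply_last_eq_zero {α β : Perm (Fin (N + 1))}
    (h : IsMinimalFactorization (finRotate (N + 1)) α β) (hα : α 0 = 0) : β (Fin.last N) = 0 :=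
  apply_last_of_apply_zero (Nat.succ_pos N) (Nat.lt_succ_self N) h hα

open Classical in
theorem rightSum_succ_succ (hc : ∀ i j, u i * v j = v j * u i) (k N : ℕ) :
    rightSum u v (k + 1) (N + 2) = ∑ p ∈ antidiagonal N,
      rightSum u v k (p.1 + 1) * factorSum u v (fun _ => FixesLast) (p.2 + 1) := by
  have hpos : ∀ p ∈ (cycleFactorizations (N + 2)).filter
      (fun p => code p.1 0 = 0 ∧ code p.2 0 = k + 1),
      (p.2.symm (Fin.last (N + 1)) : ℕ) ≠ N + 1 := by
    intro p hp h0
    obtain ⟨h1, h2, h3⟩ := mem_filter.1 hp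
    have h4 := apply_last_eq_zero (mem_cycleFactorizations.1 h1)
      ((code_zero_eq_zero_iff (Nat.succ_pos _)).1 h2)
    have h5 : p.2.symm (Fin.last (N + 1)) = Fin.last (N + 1) := Fin.ext h0
    rw [Equiv.symm_apply_eq, h4] at h5
    exact absurd (congrArg Fin.val h5) (by simp)
  -- The preimage of the last point under `β` is the last point `q.1` of the first block. It is not
  -- the last point of all, because `β` sends that one to `0`.
  rw [rightSum, ← sum_fiberwise_of_maps_to (t := antidiagonal N)
    (g := fun p => ((p.2.symm (Fin.last (N + 1)) : ℕ),
      N - (p.2.symm (Fin.last (N + 1)) : ℕ)))]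
  · refine sum_congr rfl fun q hq => ?_
    rw [HasAntidiagonal.mem_antidiagonal] at hq
    rw [← rightSum_fiber' hc k (Nat.succ_pos q.1) (Nat.succ_pos q.2)
      (show q.1 + 1 + (q.2 + 1) = N + 2 by omega), filter_filter]
    refine sum_congr ?_ fun _ _ => rfl
    ext p
    rw [mem_filter, mem_filter]
    refine and_congr_right fun _ => and_congr_right fun _ => ?_
    rw [Prod.ext_iff]
    constructor
    · intro h x hx
      simp only at h
      have : x = p.2.symm (Fin.last (N + 1)) := Fin.ext (by omega)
      rw [this, apply_symm_apply]
      rfl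
    · intro h
      have h1 := h ⟨q.1, by omega⟩ rfl
      have h2 : p.2 ⟨q.1, by omega⟩ = Fin.last (N + 1) := Fin.ext (by simp; omega)
      rw [(Equiv.symm_apply_eq _).2 h2.symm]
      exact ⟨rfl, by simp only; omega⟩
  · intro p hp
    have := hpos p hp
    have h := (p.2.symm (Fin.last (N + 1))).2
    rw [HasAntidiagonal.mem_antidiagonal]
    simp only
    omega

open Classical in
theorem leftSum_succ_one (k : ℕ) : leftSum u v S (k + 1) 1 = 0 := by
  rw [leftSum]
  refine sum_eq_zero fun p hp => ?_
  have h1 := (mem_filter.1 hp).2.1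
  have := code_zero_lt (N := 0) p.1
  omega

open Classical in
theorem rightSum_succ_one (k : ℕ) : rightSum u v (k + 1) 1 = 0 := by
  rw [rightSum]
  refine sum_eq_zero fun p hp => ?_
  have h1 := (mem_filter.1 hp).2.2
  have := code_zero_lt (N := 0) p.2
  omega

theorem cycleFactorizations_one : cycleFactorizations 1 = {(1, 1)} := by
  ext p
  rw [mem_singleton]
  constructor
  · intro _
    exact Subsingleton.elim _ _
  · rintro rfl
    rw [mem_cycleFactorizations]
    exact ⟨Subsingleton.elim _ _, by
      rw [transpositionLength_one, Subsingleton.elim (finRotate 1) 1, transpositionLength_one]⟩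

open Classical in
-- If `α` fixes the first point, then `β` sends the last point to the first; if `β` also fixes the
-- last point, there is only one point.
theorem leftSum_zero (hu : u 0 = 1) (hv : v 0 = 1) (N : ℕ) :
    leftSum u v (fun _ => FixesLast) 0 (N + 1) = if N = 0 then 1 else 0 := by
  have h0 : code (1 : Perm (Fin 1)) 0 = 0 := code_of_fixed (x := (0 : Fin 1)) rfl
  split_ifs with hN
  · subst hN
    rw [leftSum, cycleFactorizations_one, filter_singleton, if_pos, sum_singleton]
    · simp [wordProd, hu, hv, h0]
    · exact ⟨h0, fun x _ => rfl⟩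
  · rw [leftSum]
    refine sum_eq_zero fun p hp => ?_
    obtain ⟨h1, h2, h3⟩ := mem_filter.1 hp
    have h4 := apply_last_eq_zero (mem_cycleFactorizations.1 h1)
      ((code_zero_eq_zero_iff (Nat.succ_pos _)).1 h2)
    rw [h3 (Fin.last N) rfl] at h4
    exact absurd (congrArg Fin.val h4) (by simpa using hN)

open Classical in
theorem rightSum_zero (hu : u 0 = 1) (hv : v 0 = 1) (N : ℕ) :
    rightSum u v 0 (N + 1) = if N = 0 then 1 else 0 := by
  have h0 : code (1 : Perm (Fin 1)) 0 = 0 := code_of_fixed (x := (0 : Fin 1)) rfl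
  split_ifs with hN
  · subst hN
    rw [rightSum, cycleFactorizations_one, filter_singleton, if_pos, sum_singleton]
    · simp [wordProd, hu, hv, h0]
    · exact ⟨h0, h0⟩
  · rw [rightSum]
    refine sum_eq_zero fun p hp => ?_
    obtain ⟨h1, h2, h3⟩ := mem_filter.1 hp
    have h4 := apply_last_eq_zero (mem_cycleFactorizations.1 h1)
      ((code_zero_eq_zero_iff (Nat.succ_pos _)).1 h2)
    have h5 : p.2 0 = 0 := (code_zero_eq_zero_iff (Nat.succ_pos _)).1 h3
    rw [← h5] at h4
    exact absurd (congrArg Fin.val (p.2.injective h4)) (by simpa using hN)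

open Classical in
theorem factorSum_eq_sum_leftSum (hu : u 0 = 1) (N : ℕ) :
    factorSum u v S (N + 1) = ∑ p ∈ antidiagonal N, u p.1 * leftSum u v S p.1 (N + 1) := by
  rw [factorSum, ← sum_fiberwise_of_maps_to (t := antidiagonal N)
    (g := fun p => (code p.1 0, N - code p.1 0))]
  · refine sum_congr rfl fun q hq => ?_
    rw [HasAntidiagonal.mem_antidiagonal] at hq
    rw [leftSum, mul_sum, filter_filter]
    refine sum_congr (filter_congr fun p _ => ?_) fun p hp => ?_
    · rw [Prod.ext_iff, and_comm]
      simp only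
      exact and_congr_left fun _ => ⟨fun h => h.1, fun h => ⟨h, by omega⟩⟩
    · rw [wordProd_update_zero hu _ (Nat.succ_pos N), (mem_filter.1 hp).2.1, mul_assoc]
  · intro p _
    have := code_zero_lt p.1
    rw [HasAntidiagonal.mem_antidiagonal]
    simp only
    omega

open Classical in
-- The terms are sorted by the first cycle of `β`, whose weight is moved to the front past the word
-- in `u`. Erasing the first entry of `code α` changes nothing, as `α` fixes the first point.
theorem leftSum_eq_sum_rightSum (hv : v 0 = 1)
    (hc : ∀ i j, u i * v j = v j * u i) (N : ℕ) :
    leftSum u v (fun _ _ => True) 0 (N + 1)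
      = ∑ p ∈ antidiagonal N, v p.1 * rightSum u v p.1 (N + 1) := by
  rw [leftSum, ← sum_fiberwise_of_maps_to (t := antidiagonal N)
    (g := fun p => (code p.2 0, N - code p.2 0))]
  · refine sum_congr rfl fun q hq => ?_
    rw [HasAntidiagonal.mem_antidiagonal] at hq
    rw [rightSum, mul_sum, filter_filter]
    have hf : ∀ p : Perm (Fin (N + 1)) × Perm (Fin (N + 1)),
        ((code p.1 0 = 0 ∧ True) ∧ (code p.2 0, N - code p.2 0) = q) ↔
          code p.1 0 = 0 ∧ code p.2 0 = q.1 := fun p => by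
      rw [Prod.ext_iff, and_true]
      simp only
      exact and_congr_right fun _ => ⟨fun h => h.1, fun h => ⟨h, by omega⟩⟩
    refine sum_congr (by ext p; simp only [mem_filter, hf]) fun p hp => ?_
    · obtain ⟨-, h1, h2⟩ := mem_filter.1 hp
      rw [show Function.update (code p.1) 0 0 = code p.1 from Function.update_eq_self_iff.2 h1.symm,
        wordProd_update_zero hv _ (Nat.succ_pos N), h2, ← mul_assoc, ← mul_assoc]
      congr 1
      have := commute_wordProd hc (code p.1) (fun _ => q.1) (N + 1) 1
      simpa [wordProd] using this
  · intro p _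
    have := code_zero_lt p.2
    rw [HasAntidiagonal.mem_antidiagonal]
    simp only
    omega

/-! ### Functional equations of the generating series -/

/-- The generating series of a sequence indexed by the length of the long cycle. -/
noncomputable def cycleSeries (f : ℕ → A) : PowerSeries A := PowerSeries.mk fun n => f (n + 1)

theorem coeff_cycleSeries (f : ℕ → A) (n : ℕ) :
    PowerSeries.coeff n (cycleSeries f) = f (n + 1) := PowerSeries.coeff_mk _ _

theorem cycleSeries_leftSum_succ (hc : ∀ i j, u i * v j = v j * u i)
    (hS : ∀ (m n : ℕ) (α : Perm (Fin m)) (β : Perm (Fin n)), 0 < n → (S _ (dsum α β) ↔ S _ β))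
    (k : ℕ) :
    cycleSeries (leftSum u v S (k + 1)) = PowerSeries.X *
      (cycleSeries (leftSum u v (fun _ _ => True) 0) * cycleSeries (leftSum u v S k)) := by
  ext n
  rcases n with _ | n
  · rw [coeff_cycleSeries, leftSum_succ_one, PowerSeries.coeff_zero_X_mul]
  · rw [PowerSeries.coeff_succ_X_mul, PowerSeries.coeff_mul, coeff_cycleSeries,
      leftSum_succ_succ hc hS]
    simp only [coeff_cycleSeries]

theorem cycleSeries_rightSum_succ (hc : ∀ i j, u i * v j = v j * u i) (k : ℕ) :
    cycleSeries (rightSum u v (k + 1)) = PowerSeries.X *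
      (cycleSeries (rightSum u v k) * cycleSeries (factorSum u v fun _ => FixesLast)) := by
  ext n
  rcases n with _ | n
  · rw [coeff_cycleSeries, rightSum_succ_one, PowerSeries.coeff_zero_X_mul]
  · rw [PowerSeries.coeff_succ_X_mul, PowerSeries.coeff_mul, coeff_cycleSeries,
      rightSum_succ_succ hc]
    simp only [coeff_cycleSeries]

theorem cycleSeries_leftSum (hc : ∀ i j, u i * v j = v j * u i)
    (hS : ∀ (m n : ℕ) (α : Perm (Fin m)) (β : Perm (Fin n)), 0 < n → (S _ (dsum α β) ↔ S _ β))
    (k : ℕ) :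
    cycleSeries (leftSum u v S k) = PowerSeries.X ^ k *
      (cycleSeries (leftSum u v (fun _ _ => True) 0) ^ k * cycleSeries (leftSum u v S 0)) := by
  induction k with
  | zero => simp
  | succ k ih =>
    rw [cycleSeries_leftSum_succ hc hS, ih, pow_succ', pow_succ', mul_assoc, mul_assoc]
    congr 1
    rw [← mul_assoc, ((PowerSeries.commute_X _).pow_right k).eq]
    simp only [mul_assoc]

theorem cycleSeries_rightSum (hu : u 0 = 1) (hv : v 0 = 1) (hc : ∀ i j, u i * v j = v j * u i)
    (k : ℕ) :
    cycleSeries (rightSum u v k)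
      = PowerSeries.X ^ k * cycleSeries (factorSum u v fun _ => FixesLast) ^ k := by
  induction k with
  | zero =>
    ext n
    rw [coeff_cycleSeries, rightSum_zero hu hv]
    simp [PowerSeries.coeff_one]
  | succ k ih =>
    rw [cycleSeries_rightSum_succ hc, ih, pow_succ', pow_succ, mul_assoc, mul_assoc]

theorem cycleSeries_factorSum (hu : u 0 = 1) (hc : ∀ i j, u i * v j = v j * u i)
    (hS : ∀ (m n : ℕ) (α : Perm (Fin m)) (β : Perm (Fin n)), 0 < n → (S _ (dsum α β) ↔ S _ β)) :
    cycleSeries (factorSum u v S) = opSum u fun k =>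
      cycleSeries (leftSum u v (fun _ _ => True) 0) ^ k * cycleSeries (leftSum u v S 0) := by
  ext n
  rw [coeff_cycleSeries, factorSum_eq_sum_leftSum hu, coeff_opSum]
  refine sum_congr rfl fun p hp => ?_
  rw [← coeff_cycleSeries (leftSum u v S p.1), cycleSeries_leftSum hc hS, ← HasAntidiagonal.mem_antidiagonal.1 hp,
    add_comm p.1, PowerSeries.coeff_X_pow_mul]

theorem cycleSeries_leftSum_zero (hu : u 0 = 1) (hv : v 0 = 1)
    (hc : ∀ i j, u i * v j = v j * u i) :
    cycleSeries (leftSum u v (fun _ _ => True) 0)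
      = opSum v fun k => cycleSeries (factorSum u v fun _ => FixesLast) ^ k := by
  ext n
  rw [coeff_cycleSeries, leftSum_eq_sum_rightSum hv hc, coeff_opSum]
  refine sum_congr rfl fun p hp => ?_
  rw [← coeff_cycleSeries (rightSum u v p.1), cycleSeries_rightSum hu hv hc, ← HasAntidiagonal.mem_antidiagonal.1 hp,
    add_comm p.1, PowerSeries.coeff_X_pow_mul]

/-- The Lagrange series of a product of commuting families enumerates the minimal factorizations of
long cycles. -/
theorem coeff_eq_factorSum {s s' x : ℕ → A} {G U V : PowerSeries A}
    (hs : ∀ i j, s i * s' j = s' j * s i)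
    (hx : ∀ n, x n = ∑ p ∈ antidiagonal n, s p.1 * s' p.2)
    (hG : G = opSum x fun k => G ^ k)
    (hU : U = opSum s fun k => U ^ k) (hV : V = opSum s' fun k => V ^ k)
    (hU0 : PowerSeries.coeff 0 U = 1) (hV0 : PowerSeries.coeff 0 V = 1)
    (hc : ∀ i j, PowerSeries.coeff i U * PowerSeries.coeff j V
      = PowerSeries.coeff j V * PowerSeries.coeff i U) (n : ℕ) :
    PowerSeries.coeff n G = factorSum (fun k => PowerSeries.coeff k U)
      (fun k => PowerSeries.coeff k V) (fun _ _ => True) (n + 1) := by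
  have h1 : cycleSeries (leftSum (fun k => PowerSeries.coeff k U) (fun k => PowerSeries.coeff k V)
      (fun _ => FixesLast) 0) = 1 := by
    ext n
    rw [coeff_cycleSeries, leftSum_zero hU0 hV0, PowerSeries.coeff_one]
  -- With `FixesLast` the trailing factor is `1`, which gives the equation of `P`;
  -- `cycleSeries_leftSum_zero` is that of `B`. Without the condition the trailing factor is `B`
  -- itself, whence the exponent `k + 1` in `h4`.
  have h2 := cycleSeries_factorSum (S := fun _ => FixesLast) hU0 hc
    fun _ _ _ _ h => fixesLast_dsum h
  simp only [h1, mul_one] at h2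
  have h3 := lagrange_convolution hs hx hG hU hV h2 (cycleSeries_leftSum_zero hU0 hV0 hc)
  have h4 := cycleSeries_factorSum (S := fun _ _ => True) hU0 hc fun _ _ _ _ _ => Iff.rfl
  simp only [← pow_succ] at h4
  rw [h3, ← h4, coeff_cycleSeries]

end Recursion

/-! ### The Lagrange basis -/

section LagrangeBasis

open Finset

variable {A B : Type*} [Ring A] [Ring B]

theorem map_opSum (f : A →+* B) (s : ℕ → A) (F : ℕ → PowerSeries A) :
    PowerSeries.map f (opSum s F)
      = opSum (fun k => f (s k)) fun k => PowerSeries.map f (F k) := by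
  ext n
  simp [coeff_opSum]

/-- The system is unitriangular: the coefficient of `X^n` is `s_n` plus terms in earlier `s_k`. -/
theorem opSum_injective {s s' : ℕ → A} {F : ℕ → PowerSeries A}
    (hF : ∀ k, PowerSeries.coeff 0 (F k) = 1) (h : opSum s F = opSum s' F) : s = s' := by
  ext n
  induction n using Nat.strong_induction_on with
  | _ n ih =>
    have h1 := congrArg (PowerSeries.coeff n) h
    rw [coeff_opSum, coeff_opSum, Nat.sum_antidiagonal_eq_sum_range_succ_mk,
      Nat.sum_antidiagonal_eq_sum_range_succ_mk, sum_range_succ, sum_range_succ] at h1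
    simp only [Nat.sub_self, hF, mul_one] at h1
    rw [sum_congr rfl fun k hk => by rw [ih k (mem_range.1 hk)]] at h1
    exact add_left_cancel h1

theorem opSum_pow_unique {s : ℕ → A} {G H : PowerSeries A} (hG : G = opSum s fun k => G ^ k)
    (hH : H = opSum s fun k => H ^ k) : G = H := by
  refine eq_of_forall_modX fun m => ?_
  induction m with
  | zero => intro i hi; omega
  | succ m ih =>
    rw [hG, hH]
    exact ModX.opSum s (by simp) fun k => ih.pow _

variable (R : Type*) [CommRing R]

theorem lagrangeStep_eq_opSum (G : PowerSeries (NSym R)) :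
    lagrangeStep R G = opSum (complete R) fun k => G ^ k := by
  ext n
  rw [coeff_opSum, lagrangeStep, PowerSeries.coeff_mk, Nat.sum_antidiagonal_eq_sum_range_succ_mk]
  refine sum_congr rfl fun k hk => ?_
  have := mem_range.1 hk
  rw [PowerSeries.coeff_X_pow_mul', if_pos (by omega)]

theorem lagrangeSeries_eq_opSum :
    lagrangeSeries R = opSum (complete R) fun k => lagrangeSeries R ^ k := by
  rw [← lagrangeStep_eq_opSum, lagrangeStep_lagrangeSeries]

@[simp] theorem complete_zero : complete R 0 = 1 := rfl

theorem complete_coe (i : ℕ+) : complete R (i : ℕ) = FreeAlgebra.ι R i := by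
  obtain ⟨n, rfl⟩ : ∃ n : ℕ, i = n.succPNat := ⟨i.natPred, by simp⟩
  rfl

@[simp] theorem lagrange_zero : lagrange R 0 = 1 := by
  rw [lagrange, lagrangeSeries_eq_opSum, coeff_opSum]
  simp

/-! ### The automorphism `S_n ↦ g_n` -/

/-- The series `∑ S_n t^n`. -/
noncomputable def completeSeries : PowerSeries (NSym R) := PowerSeries.mk (complete R)

/-- The expressions of the `S_n` in terms of the `g_n`, written in the generators. -/
noncomputable def inverseLagrange (n : ℕ) : NSym R :=
  complete R n - ∑ k : Fin n,
    inverseLagrange k.1 * PowerSeries.coeff (n - k.1) (completeSeries R ^ k.1)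
decreasing_by exact k.2

theorem coeff_zero_completeSeries_pow (k : ℕ) :
    PowerSeries.coeff 0 (completeSeries R ^ k) = 1 := by
  simp [completeSeries, PowerSeries.coeff_zero_eq_constantCoeff_apply, map_pow]

theorem coeff_zero_lagrangeSeries_pow (k : ℕ) :
    PowerSeries.coeff 0 (lagrangeSeries R ^ k) = 1 := by
  have : PowerSeries.coeff 0 (lagrangeSeries R) = 1 := lagrange_zero R
  rw [PowerSeries.coeff_zero_eq_constantCoeff_apply] at this ⊢
  rw [map_pow, this, one_pow]

/-- The recursion of `inverseLagrange` is made for this equation: the complete series is the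
Lagrange series built from the elements `inverseLagrange R n` instead of the `S_n`. -/
theorem completeSeries_eq_opSum :
    completeSeries R = opSum (inverseLagrange R) fun k => completeSeries R ^ k := by
  ext n
  rw [coeff_opSum, Nat.sum_antidiagonal_eq_sum_range_succ_mk, sum_range_succ]
  simp only [Nat.sub_self, coeff_zero_completeSeries_pow, mul_one]
  rw [inverseLagrange, ← Fin.sum_univ_eq_sum_range
    (fun k => inverseLagrange R k * PowerSeries.coeff (n - k) (completeSeries R ^ k)),
    add_sub_cancel, completeSeries, PowerSeries.coeff_mk]

theorem inverseLagrange_zero : inverseLagrange R 0 = 1 := by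
  rw [inverseLagrange]
  simp

/-- The endomorphism `S_n ↦ g_n`. -/
noncomputable def toLagrange : NSym R →ₐ[R] NSym R :=
  FreeAlgebra.lift R fun i : ℕ+ => lagrange R i

/-- The endomorphism inverse to `S_n ↦ g_n`. -/
noncomputable def ofLagrange : NSym R →ₐ[R] NSym R :=
  FreeAlgebra.lift R fun i : ℕ+ => inverseLagrange R i

theorem toLagrange_complete (n : ℕ) : toLagrange R (complete R n) = lagrange R n := by
  rcases n with _ | n
  · simp
  · simp [complete, toLagrange]

theorem ofLagrange_complete (n : ℕ) : ofLagrange R (complete R n) = inverseLagrange R n := by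
  rcases n with _ | n
  · simp [inverseLagrange_zero]
  · simp [complete, ofLagrange]

theorem map_toLagrange_completeSeries :
    PowerSeries.map (toLagrange R : NSym R →+* NSym R) (completeSeries R) = lagrangeSeries R := by
  ext n
  rw [PowerSeries.coeff_map, completeSeries, PowerSeries.coeff_mk]
  exact toLagrange_complete R n

/-- Applying `S_n ↦ g_n` to `completeSeries_eq_opSum` gives a second expansion of the Lagrange
series in its own powers, and the coefficients of such an expansion are unique. -/
theorem toLagrange_inverseLagrange (n : ℕ) :
    toLagrange R (inverseLagrange R n) = complete R n := by
  have h := congrArg (PowerSeries.map (toLagrange R : NSym R →+* NSym R))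
    (completeSeries_eq_opSum R)
  rw [map_opSum] at h
  simp only [map_pow, map_toLagrange_completeSeries] at h
  have h2 := opSum_injective (coeff_zero_lagrangeSeries_pow R)
    (h.symm.trans (lagrangeSeries_eq_opSum R))
  exact congrFun h2 n

/-- The image of the Lagrange series and the complete series solve the same fixed point equation. -/
theorem ofLagrange_lagrange (n : ℕ) : ofLagrange R (lagrange R n) = complete R n := by
  have h := congrArg (PowerSeries.map (ofLagrange R : NSym R →+* NSym R))
    (lagrangeSeries_eq_opSum R)
  rw [map_opSum] at h
  simp only [map_pow, RingHom.coe_coe, ofLagrange_complete] at h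
  have h2 := congrArg (PowerSeries.coeff n) (opSum_pow_unique h (completeSeries_eq_opSum R))
  rw [PowerSeries.coeff_map, completeSeries, PowerSeries.coeff_mk] at h2
  exact h2

/-- The automorphism `S_n ↦ g_n`. -/
noncomputable def lagrangeEquiv : NSym R ≃ₐ[R] NSym R :=
  AlgEquiv.ofAlgHom (toLagrange R) (ofLagrange R)
    (by
      ext i
      simp only [Function.comp_apply, AlgHom.comp_apply, AlgHom.id_apply]
      rw [← complete_coe, ofLagrange_complete, toLagrange_inverseLagrange])
    (by
      ext i
      simp only [Function.comp_apply, AlgHom.comp_apply, AlgHom.id_apply]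
      rw [← complete_coe, toLagrange_complete, ofLagrange_lagrange])

/-- The products `S^J`. -/
noncomputable def completeMul (l : List ℕ) : NSym R := (l.map (complete R)).prod

/-- The basis `(S^J)`. -/
noncomputable def completeBasis : Module.Basis (List ℕ+) R (NSym R) :=
  (FreeAlgebra.basisFreeMonoid R ℕ+).reindex FreeMonoid.toList

theorem completeBasis_apply (J : List ℕ+) :
    completeBasis R J = completeMul R (J.map fun j : ℕ+ => (j : ℕ)) := by
  have h : completeBasis R J = FreeAlgebra.equivMonoidAlgebraFreeMonoid.symm
      (MonoidAlgebra.single (FreeMonoid.ofList J) 1) := by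
    simp [completeBasis, FreeAlgebra.basisFreeMonoid]
  have h' : (FreeAlgebra.equivMonoidAlgebraFreeMonoid (R := R) (X := ℕ+)).symm
      (MonoidAlgebra.single (FreeMonoid.ofList J) 1) = MonoidAlgebra.lift R (NSym R)
      (FreeMonoid ℕ+) (FreeMonoid.lift (FreeAlgebra.ι R))
      (MonoidAlgebra.single (FreeMonoid.ofList J) 1) := rfl
  rw [h, h', MonoidAlgebra.lift_single, one_smul, FreeMonoid.lift_apply, completeMul, List.map_map]
  congr 1
  exact List.map_congr_left fun i _ => (complete_coe R i).symm

/-- The basis `(g^I)`. -/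
noncomputable def lagrangeBasis : Module.Basis (List ℕ+) R (NSym R) :=
  (completeBasis R).map (lagrangeEquiv R).toLinearEquiv

theorem lagrangeBasis_apply (I : List ℕ+) : lagrangeBasis R I = lagrangeMul R I := by
  rw [lagrangeBasis, Module.Basis.map_apply, completeBasis_apply]
  simp only [completeMul, lagrangeMul, AlgEquiv.toLinearEquiv_apply, map_list_prod, List.map_map]
  congr 1
  refine List.map_congr_left fun i _ => ?_
  exact toLagrange_complete R i


/-! The grading of `NSym`. -/

/-- The homogeneous component of degree `n`. -/
def degreeComponent (n : ℕ) : Submodule R (NSym R) :=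
  Submodule.span R (completeMul R '' {l | l.sum = n})

variable {R}

theorem completeMul_append (l l' : List ℕ) :
    completeMul R (l ++ l') = completeMul R l * completeMul R l' := by
  simp [completeMul]

theorem completeMul_mem (l : List ℕ) : completeMul R l ∈ degreeComponent R l.sum :=
  Submodule.subset_span ⟨l, rfl, rfl⟩

theorem complete_mem (n : ℕ) : complete R n ∈ degreeComponent R n := by
  simpa [completeMul] using completeMul_mem (R := R) [n]

theorem one_mem_degreeComponent : (1 : NSym R) ∈ degreeComponent R 0 := complete_mem 0

theorem mul_mem_degreeComponent {x y : NSym R} {m n : ℕ} (hx : x ∈ degreeComponent R m)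
    (hy : y ∈ degreeComponent R n) : x * y ∈ degreeComponent R (m + n) := by
  have h := Submodule.mul_mem_mul hx hy
  rw [degreeComponent, degreeComponent, Submodule.span_mul_span] at h
  refine Submodule.span_mono ?_ h
  rintro _ ⟨_, ⟨l, hl, rfl⟩, _, ⟨l', hl', rfl⟩, rfl⟩
  refine ⟨l ++ l', ?_, completeMul_append l l'⟩
  simp only [Set.mem_ofPred_eq] at hl hl' ⊢
  rw [List.sum_append, hl, hl']

theorem coeff_one_mem_degreeComponent (i : ℕ) :
    PowerSeries.coeff i (1 : PowerSeries (NSym R)) ∈ degreeComponent R i := by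
  rw [PowerSeries.coeff_one]
  split_ifs with hi
  · rw [hi]
    exact one_mem_degreeComponent
  · exact zero_mem _

theorem coeff_pow_mem_degreeComponent {m : ℕ} {G : PowerSeries (NSym R)}
    (hG : ∀ i < m, PowerSeries.coeff i G ∈ degreeComponent R i) (k : ℕ) :
    ∀ i < m, PowerSeries.coeff i (G ^ k) ∈ degreeComponent R i := by
  induction k with
  | zero =>
    intro i _
    rw [pow_zero]
    exact coeff_one_mem_degreeComponent i
  | succ k ih =>
    intro i hi
    rw [pow_succ, PowerSeries.coeff_mul]
    refine Submodule.sum_mem _ fun p hp => ?_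
    have hp' := HasAntidiagonal.mem_antidiagonal.1 hp
    rw [← hp']
    exact mul_mem_degreeComponent (ih _ (by omega)) (hG _ (by omega))

theorem lagrange_mem (n : ℕ) : lagrange R n ∈ degreeComponent R n := by
  induction n using Nat.strong_induction_on with
  | _ n ih =>
    rw [lagrange, lagrangeSeries_eq_opSum, coeff_opSum]
    refine Submodule.sum_mem _ fun p hp => ?_
    have hp' := HasAntidiagonal.mem_antidiagonal.1 hp
    rw [← hp']
    refine mul_mem_degreeComponent (complete_mem _) ?_
    rcases Nat.eq_zero_or_pos p.1 with h0 | h0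
    · rw [h0, pow_zero]
      exact coeff_one_mem_degreeComponent _
    · exact coeff_pow_mem_degreeComponent (m := n) ih _ _ (by omega)

theorem inverseLagrange_mem (n : ℕ) : inverseLagrange R n ∈ degreeComponent R n := by
  induction n using Nat.strong_induction_on with
  | _ n ih =>
    rw [inverseLagrange]
    refine Submodule.sub_mem _ (complete_mem n) (Submodule.sum_mem _ fun k _ => ?_)
    have := mul_mem_degreeComponent (ih k.1 k.2)
      (coeff_pow_mem_degreeComponent (m := n + 1) (G := completeSeries R) (fun i _ => by
        rw [completeSeries, PowerSeries.coeff_mk]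
        exact complete_mem i) k.1 (n - k.1) (by omega))
    rwa [Nat.add_sub_cancel' k.2.le] at this

theorem list_prod_mem_degreeComponent {f : ℕ → NSym R} (hf : ∀ n, f n ∈ degreeComponent R n)
    (l : List ℕ) : (l.map f).prod ∈ degreeComponent R l.sum := by
  induction l with
  | nil => exact one_mem_degreeComponent
  | cons a l ih =>
    rw [List.map_cons, List.prod_cons, List.sum_cons]
    exact mul_mem_degreeComponent (hf a) ih

/-- This transfers vanishing in high degree from the `g^I` to the `S^J`, which is what bounded
degree of a dual quasi-symmetric function requires. -/
theorem ofLagrange_mem {x : NSym R} {n : ℕ} (hx : x ∈ degreeComponent R n) :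
    ofLagrange R x ∈ degreeComponent R n := by
  have : degreeComponent R n ≤ (degreeComponent R n).comap (ofLagrange R).toLinearMap := by
    conv_lhs => rw [degreeComponent]
    rw [Submodule.span_le]
    rintro _ ⟨l, rfl, rfl⟩
    rw [SetLike.mem_coe, Submodule.mem_comap, AlgHom.toLinearMap_apply, completeMul,
      map_list_prod, List.map_map]
    exact list_prod_mem_degreeComponent (fun n => by
      rw [Function.comp_apply, ofLagrange_complete]
      exact inverseLagrange_mem n) l
  exact this hx

theorem lagrangeMul_mem (I : List ℕ+) :
    lagrangeMul R I ∈ degreeComponent R (I.map fun i : ℕ+ => (i : ℕ)).sum := by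
  have := list_prod_mem_degreeComponent (lagrange_mem (R := R)) (I.map fun i : ℕ+ => (i : ℕ))
  rwa [List.map_map] at this

end LagrangeBasis

/-! ### Coefficients of quasi-symmetric functions -/

section Coefficients

open Finset

/-- The nonzero exponents of a monomial, in the order of the variables. -/
def compress (m : ℕ →₀ ℕ) : List ℕ := (m.support.sort (· ≤ ·)).map m

theorem compress_embDomain {k : ℕ} (a : Fin k →₀ ℕ) (i : Fin k ↪o ℕ) :
    compress (a.embDomain i.toEmbedding) = (a.support.sort (· ≤ ·)).map a := by
  have h := Finset.map_sort (r := (· ≤ ·)) (r' := (· ≤ ·)) (s := a.support) (f := i.toEmbedding)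
    (by simp)
  rw [compress, Finsupp.support_embDomain, ← h, List.map_map]
  exact List.map_congr_left fun x _ => Finsupp.embDomain_apply_self _ _ _

theorem length_compress (m : ℕ →₀ ℕ) : (compress m).length = m.support.card := by
  simp [compress]

theorem sum_compress (m : ℕ →₀ ℕ) : (compress m).sum = m.degree := by
  rw [compress, ((m.support.sort_perm_toList (· ≤ ·)).map m).sum_eq, Finset.sum_map_toList]
  rfl

theorem compress_toFinsupp (l : List ℕ) : compress l.toFinsupp = l.filter fun n => n ≠ 0 := by
  have h1 : l.toFinsupp.support.sort (· ≤ ·)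
      = (List.range l.length).filter fun i => l.getD i 0 ≠ 0 := by
    have hs : l.toFinsupp.support
        = ((List.range l.length).filter fun i => l.getD i 0 ≠ 0).toFinset := by
      ext i
      simp only [List.toFinsupp_support, mem_filter, mem_range, List.mem_toFinset,
        List.mem_filter, List.mem_range, decide_eq_true_eq]
    rw [hs, List.toFinset_sort _ (List.nodup_range.filter _)]
    exact List.pairwise_le_range.filter _
  have h2 : l = (List.range l.length).map fun i => l.getD i 0 := by
    refine List.ext_getElem (by simp) fun n h _ => ?_
    simp [List.getElem?_eq_getElem h]
  conv_rhs => rw [h2, List.filter_map]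
  rw [compress, h1]
  rfl

variable {R : Type*} [CommRing R]

/-- The nonzero exponents of a monomial. -/
noncomputable def exponents {m : ℕ →₀ ℕ} {k : ℕ} (h : m.support.card = k) : Fin k →₀ ℕ :=
  Finsupp.equivFunOnFinite.symm fun x => m (m.support.orderEmbOfFin h x)

theorem embDomain_exponents {m : ℕ →₀ ℕ} {k : ℕ} (h : m.support.card = k) :
    (exponents h).embDomain (m.support.orderEmbOfFin h).toEmbedding = m := by
  ext n
  by_cases hn : n ∈ Set.range (m.support.orderEmbOfFin h)
  · obtain ⟨x, rfl⟩ := hn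
    exact Finsupp.embDomain_apply_self (m.support.orderEmbOfFin h).toEmbedding _ x
  · rw [Finsupp.embDomain_of_notMem_range _ _ _ hn]
    rw [range_orderEmbOfFin] at hn
    rw [eq_comm]
    simpa using hn

/-- Both monomials are placements of the same exponent vector on `Fin k`, along the increasing
enumerations of their supports. -/
theorem IsQuasiSymmetric.coeff_eq {f : MvPowerSeries ℕ R} (hf : IsQuasiSymmetric f)
    {m m' : ℕ →₀ ℕ} (h : compress m = compress m') :
    MvPowerSeries.coeff m f = MvPowerSeries.coeff m' f := by
  have hk : m.support.card = m'.support.card := by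
    rw [← length_compress, h, length_compress]
  have e : exponents hk = exponents rfl := by
    ext x
    simp only [exponents, Finsupp.equivFunOnFinite_symm_apply_apply, orderEmbOfFin_apply]
    have h1 : (x : ℕ) < (compress m).length := by rw [length_compress, hk]; exact x.2
    have h2 := List.getElem_of_eq h h1
    simpa [compress] using h2
  have := hf _ (exponents hk) (m.support.orderEmbOfFin hk) (m'.support.orderEmbOfFin rfl)
  rwa [embDomain_exponents hk, e, embDomain_exponents] at this

/-- The composition obtained by removing the zeros. -/
def toPos : List ℕ → List ℕ+
  | [] => []
  | 0 :: l => toPos l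
  | (n + 1) :: l => n.succPNat :: toPos l

theorem toPos_map_coe (J : List ℕ+) : toPos (J.map fun j : ℕ+ => (j : ℕ)) = J := by
  induction J with
  | nil => rfl
  | cons j J ih =>
    obtain ⟨n, rfl⟩ : ∃ n : ℕ, j = n.succPNat := ⟨j.natPred, by simp⟩
    rw [List.map_cons, Nat.succPNat_coe, Nat.succ_eq_add_one, toPos, ih]

theorem map_coe_toPos (l : List ℕ) :
    ((toPos l).map fun j : ℕ+ => (j : ℕ)) = l.filter fun n => n ≠ 0 := by
  induction l with
  | nil => rfl
  | cons a l ih =>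
    rcases a with _ | a
    · simpa [toPos] using ih
    · simpa [toPos] using ih

theorem prod_filter_ne_zero {A : Type*} [Ring A] {u : ℕ → A} (hu : u 0 = 1) (l : List ℕ) :
    ((l.filter fun n => n ≠ 0).map u).prod = (l.map u).prod := by
  induction l with
  | nil => rfl
  | cons a l ih =>
    rcases Nat.eq_zero_or_pos a with rfl | ha
    · simpa [hu] using ih
    · simpa [ha.ne'] using congrArg (u a * ·) ih

theorem completeMul_toPos (l : List ℕ) :
    completeMul R ((toPos l).map fun j : ℕ+ => (j : ℕ)) = completeMul R l := by
  rw [map_coe_toPos, completeMul, prod_filter_ne_zero (complete_zero R), completeMul]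

theorem sum_filter_ne_zero (l : List ℕ) : (l.filter fun n => n ≠ 0).sum = l.sum := by
  induction l with
  | nil => rfl
  | cons a l ih =>
    rcases Nat.eq_zero_or_pos a with rfl | ha
    · simpa using ih
    · simpa [ha.ne'] using ih

theorem degree_toFinsupp (l : List ℕ) : l.toFinsupp.degree = l.sum := by
  rw [← sum_compress, compress_toFinsupp, sum_filter_ne_zero]

theorem compress_packedExponent (J : List ℕ+) :
    compress (packedExponent J) = J.map fun j : ℕ+ => (j : ℕ) := by
  rw [packedExponent, compress_toFinsupp, List.filter_eq_self]
  simp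

theorem pairing_completeBasis (f : QSym R) (J : List ℕ+) :
    pairing f (completeBasis R J) = MvPowerSeries.coeff (packedExponent J) f.1 := by
  rw [completeBasis, Module.Basis.reindex_apply, pairing, Module.Basis.constr_basis]
  rfl

/-- Zeros are allowed in `l`: they are invisible on one side because `S_0 = 1` and on the other by
quasi-symmetry. The coproduct does produce such zeros. -/
theorem pairing_completeMul (f : QSym R) (l : List ℕ) :
    pairing f (completeMul R l) = MvPowerSeries.coeff l.toFinsupp f.1 := by
  rw [← completeMul_toPos, ← completeBasis_apply, pairing_completeBasis]
  refine f.2.1.coeff_eq ?_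
  rw [compress_packedExponent, map_coe_toPos, compress_toFinsupp]

theorem ext_of_pairing {f g : QSym R} (h : pairing f = pairing g) : f = g := by
  apply Subtype.ext
  ext m
  have h1 : compress m = compress (packedExponent (toPos (compress m))) := by
    rw [compress_packedExponent, map_coe_toPos, eq_comm, List.filter_eq_self]
    simp only [compress, List.mem_map, mem_sort, Finsupp.mem_support_iff]
    rintro _ ⟨n, hn, rfl⟩
    simpa using hn
  rw [f.2.1.coeff_eq h1, g.2.1.coeff_eq h1, ← pairing_completeBasis, ← pairing_completeBasis, h]

theorem finite_sum_le (d : ℕ) : {I : List ℕ+ | (I.map fun i : ℕ+ => (i : ℕ)).sum ≤ d}.Finite := by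
  refine ((List.finite_length_le (Fin (d + 1)) d).image
    (List.map fun i => i.1.succPNat)).subset fun I hI => ?_
  have hle : ∀ i ∈ I, (i : ℕ) ≤ d := fun i hi =>
    (List.single_le_sum (by simp) _ (List.mem_map_of_mem hi)).trans hI
  have hlen : I.length ≤ (I.map fun i : ℕ+ => (i : ℕ)).sum := by
    clear hI hle
    induction I with
    | nil => simp
    | cons i I ih =>
      have := i.pos
      simp only [List.length_cons, List.map_cons, List.sum_cons]
      omega
  refine ⟨I.map fun i => Fin.ofNat (d + 1) i.natPred, ?_, ?_⟩
  · simpa using hlen.trans hI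
  · rw [List.map_map]
    conv_rhs => rw [← List.map_id I]
    refine List.map_congr_left fun i hi => ?_
    have h1 := hle i hi
    have h2 : i.natPred < d + 1 := by
      rw [PNat.natPred]
      omega
    simp [Nat.mod_eq_of_lt h2]

/-- The quasi-symmetric function with prescribed finitely many monomial coefficients. -/
noncomputable def ofCoeffs (h : List ℕ+ → R)
    (hd : ∃ d, ∀ J : List ℕ+, d < (J.map fun j : ℕ+ => (j : ℕ)).sum → h J = 0) : QSym R :=
  ⟨fun m => h (toPos (compress m)), by
    obtain ⟨d, hd⟩ := hd
    refine ⟨fun k a i j => ?_, d, fun m hm => ?_⟩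
    · change h (toPos (compress _)) = h (toPos (compress _))
      rw [compress_embDomain, compress_embDomain]
    · refine hd _ ?_
      rwa [map_coe_toPos, sum_filter_ne_zero, sum_compress]⟩

theorem pairing_ofCoeffs (h : List ℕ+ → R)
    (hd : ∃ d, ∀ J : List ℕ+, d < (J.map fun j : ℕ+ => (j : ℕ)).sum → h J = 0) (J : List ℕ+) :
    pairing (ofCoeffs h hd) (completeBasis R J) = h J := by
  rw [pairing_completeBasis]
  change h (toPos (compress _)) = h J
  rw [compress_packedExponent, toPos_map_coe]

theorem pairing_add (f g : QSym R) : pairing (f + g) = pairing f + pairing g := by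
  refine (completeBasis R).ext fun J => ?_
  simp [pairing_completeBasis]

theorem pairing_smul (r : R) (f : QSym R) : pairing (r • f) = r • pairing f := by
  refine (completeBasis R).ext fun J => ?_
  simp [pairing_completeBasis]

theorem exists_pairing_eq_zero (f : QSym R) :
    ∃ d, ∀ n, d < n → ∀ x ∈ degreeComponent R n, pairing f x = 0 := by
  obtain ⟨d, hd⟩ := f.2.2
  refine ⟨d, fun n hn x hx => ?_⟩
  have : degreeComponent R n ≤ LinearMap.ker (pairing f) := by
    rw [degreeComponent, Submodule.span_le]
    rintro _ ⟨l, rfl, rfl⟩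
    rw [SetLike.mem_coe, LinearMap.mem_ker, pairing_completeMul]
    exact hd _ (by rwa [degree_toFinsupp])
  exact this hx

theorem finite_support_pairing (f : QSym R) :
    (Function.support fun I => pairing f (lagrangeMul R I)).Finite := by
  obtain ⟨d, hd⟩ := exists_pairing_eq_zero f
  refine (finite_sum_le d).subset fun I hI => ?_
  by_contra hlt
  exact hI (hd _ (not_le.1 hlt) _ (lagrangeMul_mem I))

/-- The coefficients `⟨f, g^I⟩` of a quasi-symmetric function. -/
noncomputable def lagrangeCoeffs : QSym R →ₗ[R] List ℕ+ →₀ R where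
  toFun f := Finsupp.ofSupportFinite _ (finite_support_pairing f)
  map_add' f g := by
    ext I
    simp [Finsupp.ofSupportFinite_coe, pairing_add]
  map_smul' r f := by
    ext I
    simp [Finsupp.ofSupportFinite_coe, pairing_smul]

theorem lagrangeCoeffs_apply (f : QSym R) (I : List ℕ+) :
    lagrangeCoeffs f I = pairing f (lagrangeMul R I) := rfl

/-- Injectivity holds because the `g^I` span. For surjectivity, the linear form with prescribed
values on the `g^I` vanishes in high degree, so its values on the `S^J` are the coefficients of a
series of bounded degree. -/
theorem lagrangeCoeffs_bijective :
    Function.Bijective (lagrangeCoeffs : QSym R →ₗ[R] List ℕ+ →₀ R) := by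
  constructor
  · intro f g h
    refine ext_of_pairing ((lagrangeBasis R).ext fun I => ?_)
    rw [lagrangeBasis_apply]
    exact DFunLike.congr_fun h I
  · intro h
    let L : NSym R →ₗ[R] R := (lagrangeBasis R).constr R h
    have hL : ∀ I, L (lagrangeMul R I) = h I := fun I => by
      rw [← lagrangeBasis_apply]
      exact (lagrangeBasis R).constr_basis R h I
    obtain ⟨d, hd⟩ : ∃ d, ∀ J : List ℕ+, d < (J.map fun j : ℕ+ => (j : ℕ)).sum → h J = 0 := by
      refine ⟨h.support.sup fun J => (J.map fun j : ℕ+ => (j : ℕ)).sum, fun J hJ => ?_⟩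
      by_contra hne
      have := le_sup (f := fun J : List ℕ+ => (J.map fun j : ℕ+ => (j : ℕ)).sum)
        (Finsupp.mem_support_iff.2 hne)
      omega
    have hL0 : ∀ n, d < n → ∀ x ∈ degreeComponent R n, L (toLagrange R x) = 0 := by
      intro n hn x hx
      have : degreeComponent R n ≤ LinearMap.ker (L ∘ₗ (toLagrange R).toLinearMap) := by
        rw [degreeComponent, Submodule.span_le]
        rintro _ ⟨l, hl, rfl⟩
        rw [SetLike.mem_coe, LinearMap.mem_ker, LinearMap.comp_apply, ← completeMul_toPos,
          ← completeBasis_apply]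
        have e : (toLagrange R).toLinearMap (completeBasis R (toPos l))
            = lagrangeMul R (toPos l) := by
          rw [← lagrangeBasis_apply]
          rfl
        rw [e, hL]
        refine hd _ ?_
        rw [map_coe_toPos, sum_filter_ne_zero]
        exact hl ▸ hn
      exact this hx
    refine ⟨ofCoeffs (fun J => L (completeBasis R J)) ⟨d, fun J hJ => ?_⟩, ?_⟩
    · have h1 : completeBasis R J ∈ degreeComponent R (J.map fun j : ℕ+ => (j : ℕ)).sum := by
        rw [completeBasis_apply]
        exact completeMul_mem _
      have h2 := hL0 _ hJ _ (ofLagrange_mem h1)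
      rwa [show toLagrange R (ofLagrange R (completeBasis R J)) = completeBasis R J from
        (lagrangeEquiv R).apply_symm_apply _] at h2
    · ext I
      rw [lagrangeCoeffs_apply, ← hL]
      congr 1
      exact (completeBasis R).ext fun J => pairing_ofCoeffs _ _ J

/-- The basis of `QSym` dual to the Lagrange basis. -/
noncomputable def dualLagrangeBasis : Module.Basis (List ℕ+) R (QSym R) :=
  Module.Basis.ofRepr (LinearEquiv.ofBijective lagrangeCoeffs lagrangeCoeffs_bijective)

theorem dualLagrangeBasis_repr (f : QSym R) (I : List ℕ+) :
    dualLagrangeBasis.repr f I = pairing f (lagrangeMul R I) := rfl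

theorem isDualToLagrange_dualLagrangeBasis :
    IsDualToLagrange fun I => (dualLagrangeBasis I : QSym R) := by
  intro I J
  rw [← dualLagrangeBasis_repr, Module.Basis.repr_self, Finsupp.single_apply]

theorem IsDualToLagrange.eq {c : List ℕ+ → QSym R} (hc : IsDualToLagrange c) (I : List ℕ+) :
    c I = dualLagrangeBasis I := by
  refine ext_of_pairing ((lagrangeBasis R).ext fun J => ?_)
  rw [lagrangeBasis_apply, hc, isDualToLagrange_dualLagrangeBasis]

end Coefficients

/-! ### The coproduct -/

section Coproduct

open Finset TensorProduct

/-- The exponent vector `(a, m₀, m₁, …)`. -/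
noncomputable def consExponent (a : ℕ) (m : ℕ →₀ ℕ) : ℕ →₀ ℕ :=
  Finsupp.single 0 a + m.embDomain ⟨Nat.succ, Nat.succ_injective⟩

@[simp] theorem consExponent_zero (a : ℕ) (m : ℕ →₀ ℕ) : consExponent a m 0 = a := by
  rw [consExponent, Finsupp.add_apply, Finsupp.single_eq_same,
    Finsupp.embDomain_of_notMem_range _ _ _ (by simp), add_zero]

@[simp] theorem consExponent_succ (a : ℕ) (m : ℕ →₀ ℕ) (n : ℕ) :
    consExponent a m (n + 1) = m n := by
  rw [consExponent, Finsupp.add_apply, Finsupp.single_eq_of_ne (by omega), zero_add]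
  exact Finsupp.embDomain_apply_self ⟨Nat.succ, Nat.succ_injective⟩ m n

theorem toFinsupp_cons (a : ℕ) (l : List ℕ) :
    (a :: l).toFinsupp = consExponent a l.toFinsupp := by
  ext n
  rcases n with _ | n <;> simp

/-- The exponent vector `(m₁, m₂, …)`. -/
noncomputable def tailExponent (m : ℕ →₀ ℕ) : ℕ →₀ ℕ :=
  m.comapDomain Nat.succ Nat.succ_injective.injOn

@[simp] theorem tailExponent_apply (m : ℕ →₀ ℕ) (n : ℕ) : tailExponent m n = m (n + 1) := rfl

theorem sum_antidiagonal_consExponent {M : Type*} [AddCommMonoid M] (a : ℕ) (m : ℕ →₀ ℕ)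
    (F : (ℕ →₀ ℕ) → (ℕ →₀ ℕ) → M) :
    ∑ p ∈ antidiagonal (consExponent a m), F p.1 p.2
      = ∑ q ∈ antidiagonal a, ∑ p ∈ antidiagonal m,
          F (consExponent q.1 p.1) (consExponent q.2 p.2) := by
  rw [← sum_product']
  refine sum_nbij' (fun p => ((p.1 0, p.2 0), (tailExponent p.1, tailExponent p.2)))
    (fun x => (consExponent x.1.1 x.2.1, consExponent x.1.2 x.2.2)) ?_ ?_ ?_ ?_ ?_
  · rintro ⟨p, q⟩ h
    rw [HasAntidiagonal.mem_antidiagonal] at h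
    simp only [mem_product, HasAntidiagonal.mem_antidiagonal] at h ⊢
    constructor
    · simpa using DFunLike.congr_fun h 0
    · ext n
      simpa using DFunLike.congr_fun h (n + 1)
  · rintro ⟨⟨a, b⟩, ⟨p, q⟩⟩ h
    simp only [mem_product, HasAntidiagonal.mem_antidiagonal] at h ⊢
    obtain ⟨rfl, rfl⟩ := h
    ext n
    rcases n with _ | n <;> simp
  · rintro ⟨p, q⟩ _
    refine Prod.ext ?_ ?_ <;>
    · ext n
      rcases n with _ | n <;> simp
  · rintro ⟨⟨a, b⟩, ⟨p, q⟩⟩ _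
    simp only [consExponent_zero, Prod.mk.injEq, true_and]
    constructor <;>
    · ext n
      simp
  · rintro ⟨p, q⟩ _
    congr 1 <;>
    · ext n
      rcases n with _ | n <;> simp

variable {R : Type*} [CommRing R]

variable (R) in
/-- The coproduct `Δ S_n = ∑ S_i ⊗ S_{n-i}`. -/
noncomputable def coproduct : NSym R →ₐ[R] NSym R ⊗[R] NSym R :=
  FreeAlgebra.lift R fun i : ℕ+ =>
    ∑ p ∈ antidiagonal (i : ℕ), complete R p.1 ⊗ₜ[R] complete R p.2

theorem coproduct_complete (n : ℕ) :
    coproduct R (complete R n) = ∑ p ∈ antidiagonal n, complete R p.1 ⊗ₜ[R] complete R p.2 := by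
  rcases n with _ | n
  · simp [Algebra.TensorProduct.one_def]
  · rw [coproduct, complete, FreeAlgebra.lift_ι_apply]
    rfl

/-- The linear form `x ⊗ y ↦ ξ(x) η(y)`. -/
noncomputable def mulForm (ξ η : NSym R →ₗ[R] R) : NSym R ⊗[R] NSym R →ₗ[R] R :=
  LinearMap.mul' R R ∘ₗ TensorProduct.map ξ η

@[simp] theorem mulForm_tmul (ξ η : NSym R →ₗ[R] R) (x y : NSym R) :
    mulForm ξ η (x ⊗ₜ y) = ξ x * η y := by
  simp [mulForm]

theorem mulForm_tmul_mul (ξ η : NSym R →ₗ[R] R) (x y : NSym R) (z : NSym R ⊗[R] NSym R) :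
    mulForm ξ η (x ⊗ₜ y * z)
      = mulForm (ξ ∘ₗ LinearMap.mulLeft R x) (η ∘ₗ LinearMap.mulLeft R y) z := by
  induction z using TensorProduct.induction_on with
  | zero => simp
  | tmul a b => simp
  | add a b ha hb => rw [mul_add, map_add, map_add, ha, hb]

/-- The forms are kept general for the induction: peeling off a first factor `S_i ⊗ S_j` replaces
them by their composites with left multiplication, which prepends `i` and `j` to the exponent
vectors. -/
theorem mulForm_coproduct_completeMul (l : List ℕ) (ξ η : NSym R →ₗ[R] R) (F G : (ℕ →₀ ℕ) → R)
    (hξ : ∀ l, ξ (completeMul R l) = F l.toFinsupp)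
    (hη : ∀ l, η (completeMul R l) = G l.toFinsupp) :
    mulForm ξ η (coproduct R (completeMul R l))
      = ∑ p ∈ antidiagonal l.toFinsupp, F p.1 * G p.2 := by
  induction l generalizing ξ η F G with
  | nil =>
    have h1 := hξ []
    have h2 := hη []
    simp only [completeMul, List.map_nil, List.prod_nil, List.toFinsupp_nil] at h1 h2 ⊢
    rw [map_one, Algebra.TensorProduct.one_def, mulForm_tmul, h1, h2]
    simp
  | cons a l ih =>
    have e : ∀ (k : ℕ) (l : List ℕ), completeMul R (k :: l) = complete R k * completeMul R l :=
      fun k l => by simp [completeMul]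
    rw [e, map_mul, coproduct_complete, sum_mul, map_sum, toFinsupp_cons,
      sum_antidiagonal_consExponent a _ fun p q => F p * G q]
    refine sum_congr rfl fun q _ => ?_
    rw [mulForm_tmul_mul]
    refine ih _ _ (fun m => F (consExponent q.1 m)) (fun m => G (consExponent q.2 m)) ?_ ?_
    · intro l'
      rw [LinearMap.comp_apply, LinearMap.mulLeft_apply, ← e, hξ, toFinsupp_cons]
    · intro l'
      rw [LinearMap.comp_apply, LinearMap.mulLeft_apply, ← e, hη, toFinsupp_cons]

theorem pairing_mul (f h : QSym R) (x : NSym R) :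
    pairing (f * h) x = mulForm (pairing f) (pairing h) (coproduct R x) := by
  have : pairing (f * h) = mulForm (pairing f) (pairing h) ∘ₗ (coproduct R).toLinearMap := by
    refine (completeBasis R).ext fun J => ?_
    rw [completeBasis_apply, pairing_completeMul, LinearMap.comp_apply, AlgHom.toLinearMap_apply,
      mulForm_coproduct_completeMul _ _ _ (fun m => MvPowerSeries.coeff m f.1)
        (fun m => MvPowerSeries.coeff m h.1) (pairing_completeMul f) (pairing_completeMul h)]
    exact MvPowerSeries.coeff_mul _ _ _
  rw [this]
  rfl

end Coproduct

/-! ### Minimal factorizations of canonical permutations -/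

section Canonical

open Finset Equiv Equiv.Perm TensorProduct

open Classical in
/-- Total weight of the minimal factorizations of a permutation. -/
noncomputable def minimalSum {A : Type*} [Ring A] (u v : ℕ → A) {N : ℕ} (σ : Perm (Fin N)) : A :=
  ∑ p : Perm (Fin N) × Perm (Fin N) with IsMinimalFactorization σ p.1 p.2,
    wordProd u (code p.1) N * wordProd v (code p.2) N

theorem factorSum_true {A : Type*} [Ring A] (u v : ℕ → A) (N : ℕ) :
    factorSum u v (fun _ _ => True) N = minimalSum u v (finRotate N) := by
  simp only [factorSum, cycleFactorizations, minimalSum]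
  refine sum_congr ?_ fun _ _ => rfl
  ext p
  simp

theorem minimalSum_dsum {A : Type*} [Ring A] {u v : ℕ → A} (hc : ∀ i j, u i * v j = v j * u i)
    {m n : ℕ} (σ : Perm (Fin m)) (τ : Perm (Fin n)) :
    minimalSum u v (dsum σ τ) = minimalSum u v σ * minimalSum u v τ := by
  classical
  rw [minimalSum, minimalSum, minimalSum, sum_mul_sum, ← sum_product']
  symm
  refine sum_nbij (fun q => (dsum q.1.1 q.2.1, dsum q.1.2 q.2.2)) ?_ ?_ ?_ ?_
  · rintro ⟨⟨α₁, β₁⟩, ⟨α₂, β₂⟩⟩ h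
    simp only [mem_product, mem_filter, mem_univ, true_and] at h ⊢
    exact isMinimalFactorization_dsum.2 h
  · rintro ⟨⟨α₁, β₁⟩, ⟨α₂, β₂⟩⟩ - ⟨⟨α₁', β₁'⟩, ⟨α₂', β₂'⟩⟩ - h
    simp only [Prod.mk.injEq] at h
    obtain ⟨rfl, rfl⟩ := dsum_injective h.1
    obtain ⟨rfl, rfl⟩ := dsum_injective h.2
    rfl
  · rintro ⟨α, β⟩ h
    simp only [coe_filter, Set.mem_ofPred_eq, mem_univ, true_and] at h
    obtain ⟨α₁, β₁, α₂, β₂, rfl, rfl, h'⟩ := isMinimalFactorization_dsum_iff.1 h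
    refine ⟨((α₁, β₁), (α₂, β₂)), ?_, rfl⟩
    simpa using h'
  · rintro ⟨⟨α₁, β₁⟩, ⟨α₂, β₂⟩⟩ _
    simp only
    rw [wordProd_code_dsum, wordProd_code_dsum, mul_assoc, mul_assoc]
    congr 1
    rw [← mul_assoc, ← mul_assoc, commute_wordProd hc]

theorem minimalSum_of_isEmpty {A : Type*} [Ring A] (u v : ℕ → A) (σ : Perm (Fin 0)) :
    minimalSum u v σ = 1 := by
  have : ∀ p : Perm (Fin 0) × Perm (Fin 0), IsMinimalFactorization σ p.1 p.2 := fun p => by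
    rw [Subsingleton.elim σ 1, Subsingleton.elim p.1 1, Subsingleton.elim p.2 1]
    exact ⟨one_mul _, by rw [transpositionLength_one]⟩
  simp [minimalSum, this, wordProd]

variable {R : Type*} [CommRing R]

variable (R) in
/-- The elements `g_n ⊗ 1`. -/
noncomputable def lagrangeLeft (n : ℕ) : NSym R ⊗[R] NSym R := lagrange R n ⊗ₜ 1

variable (R) in
/-- The elements `1 ⊗ g_n`. -/
noncomputable def lagrangeRight (n : ℕ) : NSym R ⊗[R] NSym R := 1 ⊗ₜ lagrange R n

theorem lagrangeLeft_mul_lagrangeRight (i j : ℕ) :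
    lagrangeLeft R i * lagrangeRight R j = lagrangeRight R j * lagrangeLeft R i := by
  simp [lagrangeLeft, lagrangeRight]

theorem coproduct_lagrange (n : ℕ) :
    coproduct R (lagrange R n)
      = minimalSum (lagrangeLeft R) (lagrangeRight R) (finRotate (n + 1)) := by
  -- An algebra morphism carries `g(t)` to the Lagrange series of the images of the `S_n`. This is
  -- applied to the coproduct and to the two inclusions.
  have key : ∀ f : NSym R →ₐ[R] NSym R ⊗[R] NSym R,
      PowerSeries.map (f : NSym R →+* NSym R ⊗[R] NSym R) (lagrangeSeries R)
        = opSum (fun k => f (complete R k)) fun k =>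
          PowerSeries.map (f : NSym R →+* NSym R ⊗[R] NSym R) (lagrangeSeries R) ^ k := by
    intro f
    conv_lhs => rw [lagrangeSeries_eq_opSum, map_opSum]
    simp only [map_pow, RingHom.coe_coe]
  have hl : ∀ k, PowerSeries.coeff k (PowerSeries.map
      ((Algebra.TensorProduct.includeLeft : NSym R →ₐ[R] NSym R ⊗[R] NSym R) :
        NSym R →+* NSym R ⊗[R] NSym R) (lagrangeSeries R)) = lagrangeLeft R k := fun k => by
    rw [PowerSeries.coeff_map]
    rfl
  have hr : ∀ k, PowerSeries.coeff k (PowerSeries.map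
      ((Algebra.TensorProduct.includeRight : NSym R →ₐ[R] NSym R ⊗[R] NSym R) :
        NSym R →+* NSym R ⊗[R] NSym R) (lagrangeSeries R)) = lagrangeRight R k := fun k => by
    rw [PowerSeries.coeff_map]
    rfl
  have h := coeff_eq_factorSum (G := PowerSeries.map
      (coproduct R : NSym R →+* NSym R ⊗[R] NSym R) (lagrangeSeries R))
    (fun i j => by simp) (fun n => by rw [coproduct_complete]; simp) (key (coproduct R))
    (key Algebra.TensorProduct.includeLeft) (key Algebra.TensorProduct.includeRight)
    (by rw [hl, lagrangeLeft, lagrange_zero]; rfl) (by rw [hr, lagrangeRight, lagrange_zero]; rfl)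
    (fun i j => by rw [hl, hr, lagrangeLeft_mul_lagrangeRight]) n
  simp only [hl, hr, factorSum_true] at h
  rw [← h, PowerSeries.coeff_map]
  rfl

theorem coproduct_lagrangeMul (I : List ℕ+) :
    coproduct R (lagrangeMul R I)
      = minimalSum (lagrangeLeft R) (lagrangeRight R) (canonicalPerm I) := by
  induction I with
  | nil =>
    rw [lagrangeMul, List.map_nil, List.prod_nil, map_one]
    exact (minimalSum_of_isEmpty _ _ (canonicalPerm [])).symm
  | cons i I ih =>
    have e : lagrangeMul R (i :: I) = lagrange R i * lagrangeMul R I := by simp [lagrangeMul]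
    -- By definition `canonicalPerm (i :: I)` is the direct sum of a long cycle on `i + 1` points
    -- and `canonicalPerm I`.
    rw [e, map_mul, ih, coproduct_lagrange, ← minimalSum_dsum lagrangeLeft_mul_lagrangeRight]
    rfl

/-- The composition formed by the nonzero entries of the code. -/
noncomputable def codeType {N : ℕ} (w : Perm (Fin N)) : List ℕ+ :=
  toPos ((List.range N).map (code w))

theorem code_val {N : ℕ} (w : Perm (Fin N)) (i : Fin N) :
    code w i = if ∀ j, w.SameCycle i j → i ≤ j then
      (univ.filter fun j => w.SameCycle i j).card - 1 else 0 := by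
  have h1 : (∀ j, CycleRel w i j → (i : ℕ) ≤ j) ↔ ∀ j, w.SameCycle i j → i ≤ j :=
    ⟨fun h j hj => h j ⟨i.2, j.2, hj⟩, fun h j ⟨_, hj, hs⟩ => h ⟨j, hj⟩ hs⟩
  have h2 : {j | CycleRel w i j}.ncard = (univ.filter fun j => w.SameCycle i j).card := by
    rw [← card_map Fin.valEmbedding, ← Set.ncard_coe_finset]
    congr 1
    ext j
    simp only [Set.mem_ofPred_eq, coe_map, coe_filter, mem_univ, true_and, Set.mem_image]
    exact ⟨fun ⟨_, hj, hs⟩ => ⟨⟨j, hj⟩, hs, rfl⟩, fun ⟨k, hk, h⟩ => h ▸ ⟨i.2, k.2, hk⟩⟩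
  rw [code, h2]
  classical exact if_congr h1 rfl rfl

theorem map_coe_codeType {N : ℕ} (w : Perm (Fin N)) :
    ((codeType w).map fun j : ℕ+ => (j : ℕ)) = reducedOrderedCycleType w := by
  rw [codeType, map_coe_toPos, reducedOrderedCycleType, orderedCycleType,
    ← List.map_coe_finRange_eq_range, List.map_map]
  induction List.finRange N with
  | nil => rfl
  | cons i L ih =>
    rw [List.map_cons, Function.comp_apply, code_val]
    by_cases hi : ∀ j, w.SameCycle i j → i ≤ j
    · conv_rhs => rw [List.filter_cons_of_pos (by simpa using hi)]
      rw [if_pos hi, List.map_cons, List.map_cons, List.filter_cons, List.filter_cons, ih]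
    · conv_rhs => rw [List.filter_cons_of_neg (by simpa using hi)]
      rw [if_neg hi, List.filter_cons_of_neg (by simp), ih]

theorem reducedOrderedCycleType_eq_iff {N : ℕ} (w : Perm (Fin N)) (J : List ℕ+) :
    reducedOrderedCycleType w = J.map (fun j : ℕ+ => (j : ℕ)) ↔ J = codeType w := by
  rw [← map_coe_codeType, (List.map_injective_iff.2 PNat.coe_injective).eq_iff, eq_comm]

/-- The zeros of the code, at fixed points and at non-minimal points, contribute `g_0 = 1` and
disappear. -/
theorem wordProd_lagrangeLeft_mul {M N : ℕ} (α : Perm (Fin M)) (β : Perm (Fin N)) :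
    wordProd (lagrangeLeft R) (code α) M * wordProd (lagrangeRight R) (code β) N
      = lagrangeMul R (codeType α) ⊗ₜ lagrangeMul R (codeType β) := by
  have e : ∀ {N : ℕ} (w : Perm (Fin N)),
      lagrangeMul R (codeType w) = wordProd (lagrange R) (code w) N := by
    intro N w
    have h := prod_filter_ne_zero (lagrange_zero R) ((List.range N).map (code w))
    rw [← map_coe_toPos, List.map_map, List.map_map] at h
    exact h
  have hl : wordProd (lagrangeLeft R) (code α) M
      = (Algebra.TensorProduct.includeLeft : NSym R →ₐ[R] NSym R ⊗[R] NSym R)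
        (wordProd (lagrange R) (code α) M) := by
    rw [wordProd, wordProd, map_list_prod, List.map_map]
    rfl
  have hr : wordProd (lagrangeRight R) (code β) N
      = (Algebra.TensorProduct.includeRight : NSym R →ₐ[R] NSym R ⊗[R] NSym R)
        (wordProd (lagrange R) (code β) N) := by
    rw [wordProd, wordProd, map_list_prod, List.map_map]
    rfl
  rw [hl, hr, e, e]
  simp

theorem dualLagrangeBasis_repr_mul (I J K : List ℕ+) :
    dualLagrangeBasis.repr (dualLagrangeBasis J * dualLagrangeBasis K : QSym R) I
      = ((minimalFactorizations I J K).ncard : R) := by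
  classical
  have h : minimalFactorizations I J K = ((univ.filter fun p => IsMinimalFactorization
      (canonicalPerm I) p.1 p.2).filter fun p => J = codeType p.1 ∧ K = codeType p.2 :
      Finset (Perm (Fin (canonicalSize I)) × Perm (Fin (canonicalSize I)))) := by
    ext p
    simp [minimalFactorizations, reducedOrderedCycleType_eq_iff]
  rw [dualLagrangeBasis_repr, pairing_mul, coproduct_lagrangeMul, minimalSum, map_sum, h,
    Set.ncard_coe_finset, card_filter, Nat.cast_sum]
  refine sum_congr rfl fun p _ => ?_
  -- By duality each factorization contributes the indicator of `codeType α = J` and `codeType β =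
  -- K`.
  have hd := isDualToLagrange_dualLagrangeBasis (R := R)
  rw [wordProd_lagrangeLeft_mul, mulForm_tmul, hd, hd]
  split_ifs <;> simp_all

end Canonical

end LagrangeQSym

theorem mainTheorem2 (R : Type*) [CommRing R] :
    ∃ (b : Module.Basis (List ℕ+) R (LagrangeQSym.NSym R))
      (c : Module.Basis (List ℕ+) R (LagrangeQSym.QSym R)),
      (∀ I : List ℕ+, b I = LagrangeQSym.lagrangeMul R I) ∧
      LagrangeQSym.IsDualToLagrange (fun I => c I) ∧
      (∀ c' : List ℕ+ → LagrangeQSym.QSym R,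
        LagrangeQSym.IsDualToLagrange c' → ∀ I, c' I = c I) ∧
      ∀ I J K : List ℕ+,
        c.repr (c J * c K) I = ((LagrangeQSym.minimalFactorizations I J K).ncard : R) :=
  ⟨LagrangeQSym.lagrangeBasis R, LagrangeQSym.dualLagrangeBasis,
    LagrangeQSym.lagrangeBasis_apply R, LagrangeQSym.isDualToLagrange_dualLagrangeBasis,
    fun _ hc I => hc.eq I, LagrangeQSym.dualLagrangeBasis_repr_mul⟩
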